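/- Let $N\ge 2$ and let $\mathbf A$ be an $N\times N$ zero-one matrix that is aperiodic (all entries of $\mathbf A^k$ are positive for some $k\ge 1$). Let $$\Sigma=\{\omega\in\{1,\dots,N\}^{\{0,1,2,\dots\}}:\ \mathbf A(\omega_n\omega_{n+1})=1\text{ for all }n\ge 0\}$$ with the topology induced by the product topology, and let $\sigma:\Sigma\to\Sigma$, $(\sigma\omega)_n=\omega_{n+1}$, be the shift. Let $L_2$ be the finite-dimensional space, with its usual (uniform norm) topology, of all functions $f:\Sigma\to\mathbb R$ such that $f(\omega)$ depends only on $(\omega_0,\omega_1)$. For $f\in L_2$ let $\mu_f$ be the unique Gibbs measure for $f$, that is, the unique $\sigma$-invariant Borel probability measure $\mu$ on $\Sigma$ for which there are $C>0$ and $P\in\mathbb R$ with $$C^{-1}\le\frac{\mu(\{\omega':\omega'_k=\omega_k,\ 0\le k\le n-1\})}{\exp\bigl(-nP+\sum_{k=0}^{n-1}f(\sigma^k\omega)\bigr)}\le C\qquad(\omega\in\Sigma,\ n\ge 1).$$ For $f,g\in L_2$: * the systems $(\Sigma,\sigma,\mu_f)$ and $(\Sigma,\sigma,\mu_g)$ are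 called equivalent if there is a homeomorphism $\tau:\Sigma\to\Sigma$ with $\tau\circ\sigma=\sigma\circ\tau$ and $\mu_f(B)=\mu_g(\tau(B))$ for all Borel sets $B\subset\Sigma$; * they are called isomorphic if there are Borel sets $X,Y\subset\Sigma$ with $\sigma(X)\subset X$, $\sigma(Y)\subset Y$, $\mu_f(X)=\mu_g(Y)=1$ and a bijection $\Phi:X\to Y$ such that $\Phi$ and $\Phi^{-1}$ are Borel measurable, $\Phi\circ\sigma=\sigma\circ\Phi$ on $X$, and $\mu_f(B)=\mu_g(\Phi(B))$ for all Borel sets $B\subset X$. Let $[f]_2$ (respectively $[f]_3$) be the set of all $g\in L_2$ such that $(\Sigma,\sigma,\mu_f)$ and $(\Sigma,\sigma,\mu_g)$ are equivalent (respectively isomorphic). **Theorem.** If at most one symbol $i\in\{1,\dots,N\}$ has exactly one allowed successor, i.e. $$\#\bigl\{i:\ \#\{j:\mathbf A_{ij}=1\}=1\bigr\}\le 1,$$ then the set $\{f\in L_2:\ [f]_2=[f]_3\}$ contains an open dense subset of $L_2$. -/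

import Mathlib

open MeasureTheory

namespace MarkovShift

/-- The one-sided topological Markov shift with alphabet `Fin N` and zero-one transition matrix `A`.
It carries the (subspace of the) product topology of the discrete topology on `Fin N` and the
corresponding Borel sigma-algebra. -/
abbrev TMS {N : ℕ} (A : Matrix (Fin N) (Fin N) ℕ) : Type :=
  {ω : ℕ → Fin N // ∀ n, A (ω n) (ω (n + 1)) = 1}

/-- The shift map. -/
def shift {N : ℕ} (A : Matrix (Fin N) (Fin N) ℕ) (ω : TMS A) : TMS A :=
  ⟨fun n => ω.1 (n + 1), fun n => ω.2 (n + 1)⟩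

/-- All entries of `A` are zero or one. -/
def IsZeroOne {N : ℕ} (A : Matrix (Fin N) (Fin N) ℕ) : Prop :=
  ∀ i j, A i j = 0 ∨ A i j = 1

/-- Some positive power of `A` has only positive entries. -/
def IsAperiodic {N : ℕ} (A : Matrix (Fin N) (Fin N) ℕ) : Prop :=
  ∃ k : ℕ, 0 < k ∧ ∀ i j, 0 < (A ^ k) i j

/-- The number of allowed successors of the symbol `i`. -/
def numSucc {N : ℕ} (A : Matrix (Fin N) (Fin N) ℕ) (i : Fin N) : ℕ :=
  (Finset.univ.filter fun j => A i j = 1).card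

/-- `φ` depends only on the first `n` coordinates. -/
def IsLocConst {N : ℕ} (A : Matrix (Fin N) (Fin N) ℕ) (n : ℕ) (φ : TMS A → ℝ) : Prop :=
  ∀ ω ω' : TMS A, (∀ k < n, ω.1 k = ω'.1 k) → φ ω = φ ω'

/-- Every `n`-locally constant function is continuous, so nothing is lost by regarding
these functions as elements of `C(TMS A, ℝ)`. -/
theorem IsLocConst.continuous {N : ℕ} {A : Matrix (Fin N) (Fin N) ℕ} {n : ℕ} {φ : TMS A → ℝ}
    (h : IsLocConst A n φ) : Continuous φ := by
  apply IsLocallyConstant.continuous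
  rw [IsLocallyConstant.iff_eventually_eq]
  intro ω
  have h1 : ∀ k ∈ Finset.range n, ∀ᶠ y : TMS A in nhds ω, y.1 k = ω.1 k := by
    intro k _
    have hc : Continuous fun y : TMS A => y.1 k :=
      (continuous_apply k).comp continuous_subtype_val
    exact hc.continuousAt.eventually (IsOpen.mem_nhds (isOpen_discrete {ω.1 k}) rfl)
  filter_upwards [(Finset.eventually_all (Finset.range n)).2 h1] with y hy
  exact h y ω fun k hk => hy k (Finset.mem_range.2 hk)

/-- The space of real-valued `n`-locally constant functions, a (finite-dimensional) linear subspace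
of `C(TMS A, ℝ)` with the topology of uniform convergence. -/
def locConst {N : ℕ} (A : Matrix (Fin N) (Fin N) ℕ) (n : ℕ) : Submodule ℝ C(TMS A, ℝ) where
  carrier := {φ | IsLocConst A n φ}
  zero_mem' := fun _ _ _ => rfl
  add_mem' := fun {f g} hf hg ω ω' h => by
    simp only [ContinuousMap.add_apply, hf ω ω' h, hg ω ω' h]
  smul_mem' := fun c f hf ω ω' h => by
    simp only [ContinuousMap.smul_apply, hf ω ω' h]

/-- The cylinder of all points that agree with `ω` in the first `n` coordinates. -/
def cyl {N : ℕ} (A : Matrix (Fin N) (Fin N) ℕ) (ω : TMS A) (n : ℕ) : Set (TMS A) :=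
  {ω' | ∀ k < n, ω'.1 k = ω.1 k}

/-- `μ` is a Gibbs measure for `f`: a shift-invariant Borel probability measure that satisfies the
Gibbs inequality, with `birkhoffSum (shift A) f n ω` the sum of `f (σ^k ω)` over `0 ≤ k < n`. -/
structure IsGibbs {N : ℕ} (A : Matrix (Fin N) (Fin N) ℕ) (f : C(TMS A, ℝ))
    (μ : Measure (TMS A)) : Prop where
  prob : IsProbabilityMeasure μ
  invariant : MeasurePreserving (shift A) μ μ
  bound : ∃ C : ℝ, 0 < C ∧ ∃ P : ℝ, ∀ (ω : TMS A) (n : ℕ), 1 ≤ n →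
    C⁻¹ ≤ μ.real (cyl A ω n) / Real.exp (-(n : ℝ) * P + birkhoffSum (shift A) f n ω) ∧
    μ.real (cyl A ω n) / Real.exp (-(n : ℝ) * P + birkhoffSum (shift A) f n ω) ≤ C

/-- The Gibbs measure `μ_f` of `f` (for an aperiodic `A` and a Hölder continuous `f`, in particular
for a locally constant one, there is exactly one measure with `IsGibbs A f μ`). -/
noncomputable def gibbs {N : ℕ} (A : Matrix (Fin N) (Fin N) ℕ) (f : C(TMS A, ℝ)) :
    Measure (TMS A) :=
  Classical.epsilon fun μ => IsGibbs A f μ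

/-- Equivalence of the systems `(TMS A, shift, μ)` and `(TMS A, shift, ν)`: a homeomorphism `τ` that
commutes with the shift and satisfies `μ = ν ∘ τ`. -/
def AreEquivalent {N : ℕ} (A : Matrix (Fin N) (Fin N) ℕ) (μ ν : Measure (TMS A)) : Prop :=
  ∃ τ : TMS A ≃ₜ TMS A, (∀ ω, τ (shift A ω) = shift A (τ ω)) ∧
    ∀ B : Set (TMS A), MeasurableSet B → μ B = ν (τ '' B)

/-- Isomorphism of the systems `(TMS A, shift, μ)` and `(TMS A, shift, ν)`: a bimeasurable bijection
`Φ` between forward invariant Borel sets of full measure that commutes with the shift and satisfies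
`μ = ν ∘ Φ`. -/
def AreIsomorphic {N : ℕ} (A : Matrix (Fin N) (Fin N) ℕ) (μ ν : Measure (TMS A)) : Prop :=
  ∃ (X Y : Set (TMS A)) (hX : ∀ ω ∈ X, shift A ω ∈ X) (_ : ∀ ω ∈ Y, shift A ω ∈ Y) (Φ : X ≃ᵐ Y),
    MeasurableSet X ∧ MeasurableSet Y ∧ μ X = 1 ∧ ν Y = 1 ∧
    (∀ ω : X, (Φ ⟨shift A ω.1, hX ω.1 ω.2⟩ : TMS A) = shift A (Φ ω)) ∧
    ∀ B : Set X, MeasurableSet B → μ (Subtype.val '' B) = ν (Subtype.val '' (Φ '' B))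

/-- The class `[f]_2` of all `g` in `𝒞` whose Gibbs system is equivalent to that of `f`. -/
def equivClass {N : ℕ} (A : Matrix (Fin N) (Fin N) ℕ) (𝒞 : Set C(TMS A, ℝ)) (f : C(TMS A, ℝ)) :
    Set C(TMS A, ℝ) :=
  {g | g ∈ 𝒞 ∧ AreEquivalent A (gibbs A f) (gibbs A g)}

/-- The class `[f]_3` of all `g` in `𝒞` whose Gibbs system is isomorphic to that of `f`. -/
def isoClass {N : ℕ} (A : Matrix (Fin N) (Fin N) ℕ) (𝒞 : Set C(TMS A, ℝ)) (f : C(TMS A, ℝ)) :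
    Set C(TMS A, ℝ) :=
  {g | g ∈ 𝒞 ∧ AreIsomorphic A (gibbs A f) (gibbs A g)}

end MarkovShift

namespace MarkovShift

/-! A left Perron eigenvector of the transfer matrix of $f$ normalises $f$: up to a constant and a
coboundary, $f=\log q(\omega_0,\omega_1)$ with $q$ column-stochastic and supported on the allowed
transitions. The Gibbs measure of $f$ is then the unique measure for which $q(\omega_0,\omega_1)$ is
the conditional probability of $\omega_0$ given the future (`isGMeasure_gibbs`).

This conditional probability is the inverse Jacobian of the shift, so any isomorphism preserves it
almost everywhere (`measure_jac_ne_eq_zero`). Hence the code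
$\omega\mapsto(q(\omega_n,\omega_{n+1}))_n$ has the same law in isomorphic systems
(`measure_code_preimage_eq`). Gibbs measures have full support and the code is continuous on a
compact space, so the two codes also have the same range (`range_code_subset`).

Call $q$ separating if it takes distinct values on the transitions into symbols with several
predecessors; on all other allowed transitions it is $1$. A separating $q$ has an injective code
(`code_injective`), and equality of ranges forces the matrix $q'$ of the other system to be
separating too. Composing one code with the inverse of the other gives a homeomorphism that commutes
with the shift and carries one measure to the other (`areEquivalent_of_areIsomorphic`).

It remains to see that being separating is an open and dense condition on $f$. Openness comes from
projecting a closed set along a compact factor. Density comes from moving $q$ along a generic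
direction with zero column sums while keeping the eigenvector and eigenvalue. -/

/-! ### Perron-Frobenius theory -/

theorem mulVec_pos {n : Type*} [Fintype n] {B : Matrix n n ℝ} (hB : ∀ i j, 0 < B i j) {y : n → ℝ}
    (hy : ∀ i, 0 ≤ y i) (hy0 : y ≠ 0) (i : n) : 0 < (B.mulVec y) i := by
  obtain ⟨j, hj⟩ := Function.ne_iff.1 hy0
  exact Finset.sum_pos' (fun l _ => mul_nonneg (hB i l).le (hy l))
    ⟨j, Finset.mem_univ _, mul_pos (hB i j) (lt_of_le_of_ne (hy j) (Ne.symm hj))⟩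

/-- The existence part of the Perron-Frobenius theorem for primitive matrices. -/
theorem exists_pos_eigenvector {n : Type*} [Fintype n] [DecidableEq n] [Nonempty n]
    {M : Matrix n n ℝ} (h0 : ∀ i j, 0 ≤ M i j) {k : ℕ} (hk0 : 0 < k)
    (hk : ∀ i j, 0 < (M ^ k) i j) :
    ∃ (r : ℝ) (u : n → ℝ), 0 < r ∧ (∀ i, 0 < u i) ∧ M.mulVec u = r • u := by
  set T : ℝ := ∑ i, ∑ j, M i j with hT
  have hT0 : 0 ≤ T := Finset.sum_nonneg fun i _ => Finset.sum_nonneg fun j _ => h0 i j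
  have hbd : ∀ (t : ℝ) (x : n → ℝ), x ∈ stdSimplex ℝ n → (∀ i, t * x i ≤ M.mulVec x i) →
      t ≤ T := by
    intro t x hx h
    have h1 : ∑ i, t * x i ≤ ∑ i, M.mulVec x i := Finset.sum_le_sum fun i _ => h i
    rw [← Finset.mul_sum, hx.2, mul_one] at h1
    refine h1.trans (Finset.sum_le_sum fun i _ => Finset.sum_le_sum fun j _ => ?_)
    have hx1 : x j ≤ 1 := by
      rw [← hx.2]; exact Finset.single_le_sum (fun l _ => hx.1 l) (Finset.mem_univ j)
    exact mul_le_of_le_one_right (h0 i j) hx1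
  -- Collatz-Wielandt: the eigenvalue is the largest $t$ with $tx\le Mx$ for some $x$ in the
  -- simplex. The bound `T` makes the set of such pairs compact.
  let S : Set (ℝ × (n → ℝ)) :=
    (Set.Icc 0 T ×ˢ stdSimplex ℝ n) ∩ {p | ∀ i, p.1 * p.2 i ≤ M.mulVec p.2 i}
  have hS : IsCompact S := by
    refine (isCompact_Icc.prod (isCompact_stdSimplex ℝ n)).inter_right ?_
    simp only [Set.ofPred_forall]
    refine isClosed_iInter fun i => isClosed_le (by fun_prop) ?_
    simp only [Matrix.mulVec, dotProduct]
    fun_prop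
  have hSne : S.Nonempty := by
    obtain ⟨i⟩ := ‹Nonempty n›
    refine ⟨(0, Pi.single i 1), ⟨⟨⟨le_rfl, hT0⟩, single_mem_stdSimplex ℝ i⟩, fun j => ?_⟩⟩
    simp only [zero_mul, Matrix.mulVec_single_one]
    exact h0 j i
  obtain ⟨⟨r, x⟩, ⟨⟨⟨hr0, -⟩, hx⟩, hrx⟩, hmax⟩ := hS.exists_isMaxOn hSne continuous_fst.continuousOn
  simp only at hr0 hx hrx
  have hxne : x ≠ 0 := by
    rintro rfl
    simpa using hx.2
  set z := (M ^ k).mulVec x with hz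
  have hzpos : ∀ i, 0 < z i := mulVec_pos hk hx.1 hxne
  -- If $Mx\ne rx$, then $M^k$ makes the nonnegative defect strictly positive in every coordinate,
  -- so $M^kx$ admits a constant larger than $r$.
  have heig : M.mulVec x = r • x := by
    by_contra hne
    have hy0 : M.mulVec x - r • x ≠ 0 := sub_ne_zero.2 hne
    have hypos : ∀ i, 0 < ((M ^ k).mulVec (M.mulVec x - r • x)) i :=
      mulVec_pos hk (fun i => by simpa using hrx i) hy0
    have hcomm : (M ^ k).mulVec (M.mulVec x - r • x) = M.mulVec z - r • z := by
      rw [Matrix.mulVec_sub, Matrix.mulVec_smul, hz, Matrix.mulVec_mulVec, Matrix.mulVec_mulVec,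
        pow_mul_comm']
    rw [hcomm] at hypos
    obtain ⟨i0, hi0⟩ := Finite.exists_min fun i => (M.mulVec z - r • z) i / z i
    set ε := (M.mulVec z - r • z) i0 / z i0 with hε
    have hεpos : 0 < ε := div_pos (hypos i0) (hzpos i0)
    set s := ∑ i, z i with hs
    have hspos : 0 < s := Finset.sum_pos (fun i _ => hzpos i) Finset.univ_nonempty
    have hmem : s⁻¹ • z ∈ stdSimplex ℝ n := by
      refine ⟨fun i => mul_nonneg (inv_nonneg.2 hspos.le) (hzpos i).le, ?_⟩
      simp only [Pi.smul_apply, smul_eq_mul]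
      rw [← Finset.mul_sum, inv_mul_cancel₀ hspos.ne']
    have hle : ∀ i, (r + ε) * (s⁻¹ • z) i ≤ M.mulVec (s⁻¹ • z) i := by
      intro i
      have h1 := (le_div_iff₀ (hzpos i)).1 (hi0 i)
      simp only [Pi.sub_apply, Pi.smul_apply, smul_eq_mul] at h1
      rw [Matrix.mulVec_smul]
      simp only [Pi.smul_apply, smul_eq_mul]
      calc (r + ε) * (s⁻¹ * z i) = s⁻¹ * ((r + ε) * z i) := by ring
        _ ≤ _ := mul_le_mul_of_nonneg_left (by linarith) (inv_nonneg.2 hspos.le)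
    have h2 := hmax (show (r + ε, s⁻¹ • z) ∈ S from
      ⟨⟨⟨add_nonneg hr0 hεpos.le, hbd _ _ hmem hle⟩, hmem⟩, hle⟩)
    simp only [Set.mem_ofPred_eq] at h2
    linarith
  have hpow : ∀ m : ℕ, (M ^ m).mulVec x = r ^ m • x := by
    intro m
    induction m with
    | zero => simp
    | succ m ih =>
      rw [pow_succ, ← Matrix.mulVec_mulVec, heig, Matrix.mulVec_smul, ih, smul_smul, pow_succ,
        mul_comm]
  have hzi : ∀ i, 0 < r ^ k * x i := fun i => by
    have := hzpos i
    rwa [hz, hpow k] at this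
  refine ⟨r, x, lt_of_le_of_ne hr0 ?_, fun i => ?_, heig⟩
  · rintro rfl
    have := hzi (Classical.arbitrary n)
    rw [zero_pow hk0.ne', zero_mul] at this
    exact this.false
  · exact pos_of_mul_pos_right (hzi i) (pow_nonneg hr0 k)

/-- Positivity of the entries of a power depends only on the pattern of positive entries. This
carries aperiodicity from `A` to weighted matrices. -/
theorem pow_pos_of_pos {n : Type*} [Fintype n] [DecidableEq n] {A : Matrix n n ℕ}
    {M : Matrix n n ℝ} (h0 : ∀ i j, 0 ≤ M i j) (h : ∀ i j, 0 < A i j → 0 < M i j) (k : ℕ) (i j : n)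
    (hk : 0 < (A ^ k) i j) : 0 < (M ^ k) i j := by
  have hnn : ∀ (k : ℕ) (i j : n), 0 ≤ (M ^ k) i j := by
    intro k
    induction k with
    | zero => intro i j; rw [pow_zero, Matrix.one_apply]; split_ifs <;> norm_num
    | succ k ih =>
      intro i j
      rw [pow_succ, Matrix.mul_apply]
      exact Finset.sum_nonneg fun l _ => mul_nonneg (ih i l) (h0 l j)
  induction k generalizing j with
  | zero =>
    rw [pow_zero, Matrix.one_apply] at hk ⊢
    split_ifs at hk ⊢ <;> simp_all
  | succ k ih =>
    rw [pow_succ, Matrix.mul_apply] at hk ⊢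
    obtain ⟨l, -, hl⟩ := Finset.exists_ne_zero_of_sum_ne_zero hk.ne'
    have hl' := mul_ne_zero_iff.1 hl
    exact Finset.sum_pos' (fun l _ => mul_nonneg (hnn k i l) (h0 l j)) ⟨l, Finset.mem_univ _,
      mul_pos (ih l (Nat.pos_of_ne_zero hl'.1)) (h l j (Nat.pos_of_ne_zero hl'.2))⟩

variable {N : ℕ} {A : Matrix (Fin N) (Fin N) ℕ}

/-! ### The shift space and its cylinders -/

theorem continuous_coord (k : ℕ) : Continuous fun ω : TMS A => ω.1 k :=
  (continuous_apply k).comp continuous_subtype_val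

theorem measurable_coord (k : ℕ) : Measurable fun ω : TMS A => ω.1 k :=
  (continuous_coord k).measurable

theorem continuous_shift : Continuous (shift A) :=
  Continuous.subtype_mk (continuous_pi fun n => continuous_coord (n + 1)) _

theorem measurable_shift : Measurable (shift A) := continuous_shift.measurable

theorem shift_iterate_apply (ω : TMS A) (n k : ℕ) : ((shift A)^[n] ω).1 k = ω.1 (k + n) := by
  induction n generalizing ω with
  | zero => rfl
  | succ n ih => rw [Function.iterate_succ_apply, ih]; rfl

theorem isClosed_admissible (A : Matrix (Fin N) (Fin N) ℕ) :
    IsClosed {ω : ℕ → Fin N | ∀ n, A (ω n) (ω (n + 1)) = 1} := by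
  simp only [Set.ofPred_forall]
  refine isClosed_iInter fun n => ?_
  have : Continuous fun ω : ℕ → Fin N => (ω n, ω (n + 1)) := by fun_prop
  exact (isClosed_discrete {p : Fin N × Fin N | A p.1 p.2 = 1}).preimage this

instance instCompactSpaceTMS : CompactSpace (TMS A) :=
  isCompact_iff_compactSpace.1 (isClosed_admissible A).isCompact

instance instPolishSpaceTMS : PolishSpace (TMS A) :=
  have : PolishSpace (Fin N) := {}
  (isClosed_admissible A).polishSpace

/-- The point `i ω₀ ω₁ …`. -/
def cons (i : Fin N) (ω : TMS A) (h : A i (ω.1 0) = 1) : TMS A :=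
  ⟨fun n => Nat.casesOn n i ω.1, fun n => by cases n with
    | zero => exact h
    | succ n => exact ω.2 n⟩

theorem exists_succ (hA : IsZeroOne A) (hper : IsAperiodic A) (i : Fin N) : ∃ j, A i j = 1 := by
  obtain ⟨k, hk, h⟩ := hper
  obtain ⟨k, rfl⟩ := Nat.exists_eq_succ_of_ne_zero hk.ne'
  have := h i i
  rw [pow_succ', Matrix.mul_apply] at this
  obtain ⟨l, -, hl⟩ := Finset.exists_ne_zero_of_sum_ne_zero this.ne'
  exact ⟨l, (hA i l).resolve_left (left_ne_zero_of_mul hl)⟩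

theorem exists_point (hA : IsZeroOne A) (hper : IsAperiodic A) (i : Fin N) :
    ∃ ω : TMS A, ω.1 0 = i := by
  choose s hs using exists_succ hA hper
  refine ⟨⟨fun n => s^[n] i, fun n => ?_⟩, rfl⟩
  change A (s^[n] i) (s^[n + 1] i) = 1
  rw [Function.iterate_succ_apply']
  exact hs _

theorem exists_point_edge (hA : IsZeroOne A) (hper : IsAperiodic A) {i j : Fin N}
    (h : A i j = 1) : ∃ ω : TMS A, ω.1 0 = i ∧ ω.1 1 = j := by
  obtain ⟨ω, rfl⟩ := exists_point hA hper j
  exact ⟨cons i ω h, rfl, rfl⟩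

theorem measurableSet_cyl (ω : TMS A) (n : ℕ) : MeasurableSet (cyl A ω n) := by
  have : cyl A ω n = ⋂ k, ⋂ _ : k < n, (fun ω' : TMS A => ω'.1 k) ⁻¹' {ω.1 k} := by
    ext; simp [cyl]
  rw [this]
  exact MeasurableSet.iInter fun k => MeasurableSet.iInter fun _ =>
    measurable_coord k (measurableSet_singleton _)

/-- The first `n` coordinates of a point. -/
def word (n : ℕ) (ω : TMS A) : Fin n → Fin N := fun k => ω.1 k

theorem measurable_word (n : ℕ) : Measurable (word n : TMS A → _) :=
  measurable_pi_lambda _ fun k => measurable_coord k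

theorem word_preimage_singleton (n : ℕ) (ω : TMS A) : word n ⁻¹' {word n ω} = cyl A ω n := by
  ext ω'
  simp only [Set.mem_preimage, Set.mem_singleton_iff, funext_iff, word, cyl, Set.mem_ofPred_eq]
  exact ⟨fun h k hk => h ⟨k, hk⟩, fun h k => h k k.2⟩

theorem measure_word_preimage_le {μ ν : Measure (TMS A)} {n : ℕ}
    (h : ∀ ω, μ (cyl A ω n) ≤ ν (cyl A ω n)) (W : Set (Fin n → Fin N)) :
    μ (word n ⁻¹' W) ≤ ν (word n ⁻¹' W) := by
  classical
  have hW : (word n ⁻¹' W : Set (TMS A)) = ⋃ w ∈ W.toFinset, word n ⁻¹' {w} := by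
    ext; simp
  have hd : Set.PairwiseDisjoint (W.toFinset : Set (Fin n → Fin N))
      fun w => (word n ⁻¹' {w} : Set (TMS A)) := fun w _ w' _ hww =>
    Disjoint.preimage _ (by simpa using hww)
  have hm : ∀ w ∈ W.toFinset, MeasurableSet (word n ⁻¹' {w} : Set (TMS A)) :=
    fun w _ => measurable_word n (measurableSet_singleton w)
  rw [hW, measure_biUnion_finset hd hm, measure_biUnion_finset hd hm]
  refine Finset.sum_le_sum fun w _ => ?_
  rcases (word n ⁻¹' {w} : Set (TMS A)).eq_empty_or_nonempty with he | ⟨ω, hω⟩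
  · simp [he]
  · obtain rfl : word n ω = w := hω
    rw [word_preimage_singleton]
    exact h ω

/-- A closed set is the decreasing intersection of the unions of cylinders that meet it; inner
regularity extends the comparison to Borel sets. The inequality form is what ergodicity and
uniqueness of the Gibbs measure need. -/
theorem measure_le_of_cyl {μ ν : Measure (TMS A)} [IsFiniteMeasure μ] [IsFiniteMeasure ν]
    (h : ∀ ω n, μ (cyl A ω (n + 1)) ≤ ν (cyl A ω (n + 1))) : μ ≤ ν := by
  have hcl : ∀ K : Set (TMS A), IsClosed K → μ K ≤ ν K := by
    intro K hK
    let s : ℕ → Set (TMS A) := fun n => word (n + 1) ⁻¹' (word (n + 1) '' K)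
    have hs : ∀ n, MeasurableSet (s n) := fun n =>
      measurable_word _ (Set.toFinite _).measurableSet
    have hanti : Antitone s := by
      rintro m n hmn ω ⟨ω', hω', he⟩
      refine ⟨ω', hω', funext fun k => ?_⟩
      exact congrFun he ⟨k, by omega⟩
    have hK' : ⋂ n, s n = K := by
      refine Set.Subset.antisymm (fun ω hω => ?_) fun ω hω => Set.mem_iInter.2 fun n => ⟨ω, hω, rfl⟩
      rw [Set.mem_iInter] at hω
      choose u hu hw using hω
      refine hK.mem_of_tendsto (b := Filter.atTop) (f := u) ?_ (Filter.Eventually.of_forall hu)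
      rw [tendsto_subtype_rng, tendsto_pi_nhds]
      intro k
      refine tendsto_const_nhds.congr' ?_
      filter_upwards [Filter.eventually_ge_atTop k] with n hn
      exact (congrFun (hw n) ⟨k, by omega⟩).symm
    have h1 := tendsto_measure_iInter_atTop (μ := μ) (fun n => (hs n).nullMeasurableSet) hanti
      ⟨0, measure_ne_top _ _⟩
    have h2 := tendsto_measure_iInter_atTop (μ := ν) (fun n => (hs n).nullMeasurableSet) hanti
      ⟨0, measure_ne_top _ _⟩
    rw [hK'] at h1 h2
    exact le_of_tendsto_of_tendsto' h1 h2 fun n =>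
      measure_word_preimage_le (fun ω => h ω n) _
  refine Measure.le_iff.2 fun s hs => ?_
  rw [hs.measure_eq_iSup_isClosed_of_ne_top (measure_ne_top μ s)]
  exact iSup₂_le fun K hKs => iSup_le fun hK => (hcl K hK).trans (measure_mono hKs)

theorem measure_eq_of_cyl {μ ν : Measure (TMS A)} [IsFiniteMeasure μ] [IsFiniteMeasure ν]
    (h : ∀ ω n, μ (cyl A ω (n + 1)) = ν (cyl A ω (n + 1))) : μ = ν :=
  le_antisymm (measure_le_of_cyl fun ω n => (h ω n).le) (measure_le_of_cyl fun ω n => (h ω n).ge)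

/-! ### Column-stochastic matrices and the construction of their measures -/

/-- `q` is a column-stochastic matrix whose positive entries are the allowed transitions. -/
structure IsGMatrix (A : Matrix (Fin N) (Fin N) ℕ) (q : Matrix (Fin N) (Fin N) ℝ) : Prop where
  pos : ∀ i j, A i j = 1 → 0 < q i j
  zero : ∀ i j, A i j ≠ 1 → q i j = 0
  sum : ∀ j, ∑ i, q i j = 1

theorem IsGMatrix.nonneg {q : Matrix (Fin N) (Fin N) ℝ} (hq : IsGMatrix A q) (i j : Fin N) :
    0 ≤ q i j := by
  by_cases h : A i j = 1
  · exact (hq.pos i j h).le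
  · exact (hq.zero i j h).ge

theorem IsGMatrix.exists_pow_pos {q : Matrix (Fin N) (Fin N) ℝ} (hq : IsGMatrix A q)
    (hA : IsZeroOne A) (hper : IsAperiodic A) : ∃ k, 0 < k ∧ ∀ i j, 0 < (q ^ k) i j := by
  obtain ⟨k, hk0, hk⟩ := hper
  exact ⟨k, hk0, fun i j => pow_pos_of_pos hq.nonneg
    (fun i j h => hq.pos i j ((hA i j).resolve_left h.ne')) k i j (hk i j)⟩

/-- `μ` is a probability measure under which the conditional probability of a symbol given the
future is prescribed by `q`. -/
structure IsGMeasure (q : Matrix (Fin N) (Fin N) ℝ) (μ : Measure (TMS A)) : Prop where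
  prob : IsProbabilityMeasure μ
  jac : ∀ (i j : Fin N) (D : Set (TMS A)), MeasurableSet D →
    μ {ω | ω.1 0 = i ∧ ω.1 1 = j ∧ shift A ω ∈ D} =
      ENNReal.ofReal (q i j) * μ {ω | ω.1 0 = j ∧ ω ∈ D}

/-- The trajectory of a random walk on the alphabet that is driven by `U`: the starting point is
`U none`, and the step at time `n` from `i` is made with the input `U (some (n, i))`. -/
def chain (step : Fin N → Fin N → Fin N) (U : Option (ℕ × Fin N) → Fin N) : ℕ → Fin N
  | 0 => U none
  | n + 1 => step (chain step U n) (U (some (n, chain step U n)))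

theorem chain_eq_iff (step : Fin N → Fin N → Fin N) (U : Option (ℕ × Fin N) → Fin N)
    (w : ℕ → Fin N) (n : ℕ) : (∀ k < n + 1, chain step U k = w k) ↔
      U none = w 0 ∧ ∀ k < n, step (w k) (U (some (k, w k))) = w (k + 1) := by
  constructor
  · intro h
    refine ⟨h 0 n.succ_pos, fun k hk => ?_⟩
    rw [← h k (by omega), ← h (k + 1) (by omega)]
    rfl
  · rintro ⟨h0, h⟩ k
    induction k with
    | zero => exact fun _ => h0
    | succ k ih =>
      intro hk
      have := ih (by omega)
      rw [chain, this]
      exact h k (by omega)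

theorem measurable_chain (step : Fin N → Fin N → Fin N) (n : ℕ) :
    Measurable fun U => chain step U n := by
  induction n with
  | zero => exact measurable_pi_apply none
  | succ n ih =>
    have h1 : Measurable fun p : Fin N × (Option (ℕ × Fin N) → Fin N) =>
        step p.1 (p.2 (some (n, p.1))) :=
      measurable_from_prod_countable_right fun i =>
        (measurable_of_countable (step i)).comp (measurable_pi_apply (some (n, i)))
    exact h1.comp (ih.prodMk measurable_id)

/-- Following `w` constrains only the inputs at the distinct indices `none` and `some (k, w k)`, so
the event is a box in a product space. -/
theorem infinitePi_chain (step : Fin N → Fin N → Fin N) (m : Option (ℕ × Fin N) → Measure (Fin N))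
    [∀ i, IsProbabilityMeasure (m i)] (w : ℕ → Fin N) (n : ℕ) :
    Measure.infinitePi m {U | ∀ k < n + 1, chain step U k = w k} =
      m none {w 0} * ∏ k ∈ Finset.range n, m (some (k, w k)) {u | step (w k) u = w (k + 1)} := by
  classical
  let t : Option (ℕ × Fin N) → Set (Fin N) := fun o =>
    o.elim {w 0} fun p => {u | step p.2 u = w (p.1 + 1)}
  let s : Finset (Option (ℕ × Fin N)) :=
    insert none ((Finset.range n).image fun k => some (k, w k))
  have hset : {U | ∀ k < n + 1, chain step U k = w k} = Set.pi (s : Set (Option (ℕ × Fin N))) t := by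
    ext U
    simp only [Set.mem_ofPred_eq, chain_eq_iff, s, t]
    simp
  rw [hset, Measure.infinitePi_pi _ fun _ _ => (Set.toFinite _).measurableSet]
  simp only [s]
  rw [Finset.prod_insert (by simp), Finset.prod_image (fun a _ b _ h => by simpa using (congrArg (Option.map Prod.fst) h))]
  rfl

/-- A column-stochastic matrix has a stationary probability vector. -/
theorem IsGMatrix.exists_stationary {q : Matrix (Fin N) (Fin N) ℝ} (hq : IsGMatrix A q)
    (hN : 2 ≤ N) (hA : IsZeroOne A) (hper : IsAperiodic A) :
    ∃ p : Fin N → ℝ, (∀ i, 0 < p i) ∧ ∑ i, p i = 1 ∧ ∀ i, ∑ j, q i j * p j = p i := by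
  have : Nonempty (Fin N) := ⟨⟨0, by omega⟩⟩
  obtain ⟨k, hk0, hk⟩ := hq.exists_pow_pos hA hper
  obtain ⟨r, u, hr, hu, h⟩ := exists_pos_eigenvector hq.nonneg hk0 hk
  have hs : 0 < ∑ i, u i := Finset.sum_pos (fun i _ => hu i) Finset.univ_nonempty
  have h' : ∀ i, ∑ j, q i j * u j = r * u i := fun i => congrFun h i
  have hr1 : r = 1 := by
    have h1 : ∑ i, ∑ j, q i j * u j = ∑ j, u j := by
      rw [Finset.sum_comm]
      exact Finset.sum_congr rfl fun j _ => by rw [← Finset.sum_mul, hq.sum, one_mul]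
    simp only [h', ← Finset.mul_sum] at h1
    exact (mul_eq_right₀ hs.ne').1 h1
  refine ⟨fun i => u i / ∑ i, u i, fun i => div_pos (hu i) hs, ?_, fun i => ?_⟩
  · rw [← Finset.sum_div, div_self hs.ne']
  · simp only [← mul_div_assoc, ← Finset.sum_div, h', hr1, one_mul]

theorem sum_smul_dirac_apply {p : Fin N → ℝ} (hp : ∀ i, 0 ≤ p i) (s : Set (Fin N))
    [DecidablePred (· ∈ s)] :
    (∑ i, ENNReal.ofReal (p i) • Measure.dirac i) s =
      ENNReal.ofReal (∑ i, if i ∈ s then p i else 0) := by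
  rw [ENNReal.ofReal_sum_of_nonneg fun i _ => by split_ifs <;> simp [hp], Measure.finsetSum_apply]
  refine Finset.sum_congr rfl fun i _ => ?_
  rw [Measure.smul_apply, Measure.dirac_apply' _ (Set.toFinite _).measurableSet]
  by_cases h : i ∈ s <;> simp [h]

theorem IsGMatrix.exists_measure_cyl {q : Matrix (Fin N) (Fin N) ℝ} (hq : IsGMatrix A q)
    (hN : 2 ≤ N) (hA : IsZeroOne A) (hper : IsAperiodic A) :
    ∃ (p : Fin N → ℝ) (μ : Measure (TMS A)), IsProbabilityMeasure μ ∧ ∀ ω n,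
      μ (cyl A ω (n + 1)) = (∏ k ∈ Finset.range n, ENNReal.ofReal (q (ω.1 k) (ω.1 (k + 1)))) *
        ENNReal.ofReal (p (ω.1 n)) := by
  obtain ⟨p, hp, hp1, hst⟩ := hq.exists_stationary hN hA hper
  choose s hs using exists_succ hA hper
  -- Inputs that are not allowed successors are redirected, so that every trajectory is admissible.
  -- They have weight zero under the step laws `c`.
  let step : Fin N → Fin N → Fin N := fun i u => if A i u = 1 then u else s i
  have hstep : ∀ i u, A i (step i u) = 1 := fun i u => by
    simp only [step]; split_ifs with h
    exacts [h, hs i]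
  -- The forward transition probabilities obtained from the backward ones `q` by Bayes' rule; along
  -- a cylinder the factors `p` telescope.
  let c : Option (ℕ × Fin N) → Fin N → ℝ := fun o =>
    o.elim p fun x j => q x.2 j * p j / p x.2
  have hc : ∀ o i, 0 ≤ c o i := by
    rintro (_ | x) i
    · exact (hp i).le
    · exact div_nonneg (mul_nonneg (hq.nonneg _ _) (hp i).le) (hp _).le
  have hc1 : ∀ o, ∑ i, c o i = 1 := by
    rintro (_ | x)
    · exact hp1
    · change ∑ j, q x.2 j * p j / p x.2 = 1
      rw [← Finset.sum_div, hst, div_self (hp _).ne']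
  let m : Option (ℕ × Fin N) → Measure (Fin N) := fun o =>
    ∑ i, ENNReal.ofReal (c o i) • Measure.dirac i
  have hm : ∀ o, IsProbabilityMeasure (m o) := fun o => ⟨by
    classical
    simp only [m]
    rw [sum_smul_dirac_apply (hc o)]
    simp [hc1]⟩
  let F : (Option (ℕ × Fin N) → Fin N) → TMS A := fun U => ⟨chain step U, fun n => hstep _ _⟩
  have hF : Measurable F :=
    Measurable.subtype_mk (measurable_pi_lambda _ fun n => measurable_chain step n)
  refine ⟨p, (Measure.infinitePi m).map F, Measure.isProbabilityMeasure_map hF.aemeasurable,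
    fun ω n => ?_⟩
  rw [Measure.map_apply hF (measurableSet_cyl ω _)]
  have h1 : F ⁻¹' cyl A ω (n + 1) = {U | ∀ k < n + 1, chain step U k = ω.1 k} := rfl
  have h2 : ∀ k, m (some (k, ω.1 k)) {u | step (ω.1 k) u = ω.1 (k + 1)} =
      ENNReal.ofReal (q (ω.1 k) (ω.1 (k + 1)) * p (ω.1 (k + 1)) / p (ω.1 k)) := by
    intro k
    classical
    simp only [m]
    rw [sum_smul_dirac_apply (hc _)]
    congr 1
    rw [Finset.sum_eq_single (ω.1 (k + 1))]
    · simp [step, ω.2 k, c]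
    · intro u _ hu
      by_cases h : A (ω.1 k) u = 1
      · simp [step, h, hu]
      · simp [c, hq.zero _ _ h]
    · simp
  have h0 : m none {ω.1 0} = ENNReal.ofReal (p (ω.1 0)) := by
    classical
    simp only [m]
    rw [sum_smul_dirac_apply (hc _)]
    simp [c]
  rw [h1, infinitePi_chain, h0]
  simp only [h2]
  induction n with
  | zero => simp
  | succ n ih =>
    rw [Finset.prod_range_succ, ← mul_assoc, ih rfl, Finset.prod_range_succ, mul_assoc, mul_assoc]
    congr 1
    rw [← ENNReal.ofReal_mul (hp _).le, ← ENNReal.ofReal_mul (hq.nonneg _ _),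
      mul_div_cancel₀ _ (hp _).ne']

theorem IsGMatrix.exists_isGMeasure {q : Matrix (Fin N) (Fin N) ℝ} (hq : IsGMatrix A q)
    (hN : 2 ≤ N) (hA : IsZeroOne A) (hper : IsAperiodic A) :
    ∃ μ : Measure (TMS A), IsGMeasure q μ := by
  obtain ⟨p, μ, hμ, hcyl⟩ := hq.exists_measure_cyl hN hA hper
  refine ⟨μ, hμ, fun i j D hD => ?_⟩
  have hE : MeasurableSet {ω : TMS A | ω.1 0 = i ∧ ω.1 1 = j} :=
    (measurable_coord 0 (measurableSet_singleton i)).inter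
      (measurable_coord 1 (measurableSet_singleton j))
  have hEj : MeasurableSet {ω : TMS A | ω.1 0 = j} :=
    measurable_coord 0 (measurableSet_singleton j)
  -- Both sides of the Jacobian identity are measures in `D`, so cylinders suffice, and there
  -- prepending `i` adds one factor `q i j`.
  have heq : (μ.restrict {ω | ω.1 0 = i ∧ ω.1 1 = j}).map (shift A) =
      ENNReal.ofReal (q i j) • μ.restrict {ω | ω.1 0 = j} := by
    have : IsFiniteMeasure (ENNReal.ofReal (q i j) • μ.restrict {ω : TMS A | ω.1 0 = j}) :=
      Measure.smul_finite _ ENNReal.ofReal_ne_top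
    refine measure_eq_of_cyl fun ω n => ?_
    have hm := measurableSet_cyl ω (n + 1)
    rw [Measure.map_apply measurable_shift hm, Measure.restrict_apply (measurable_shift hm),
      Measure.smul_apply, Measure.restrict_apply hm, smul_eq_mul]
    by_cases hj : ω.1 0 = j
    · by_cases hij : A i (ω.1 0) = 1
      · have e1 : shift A ⁻¹' cyl A ω (n + 1) ∩ {ω | ω.1 0 = i ∧ ω.1 1 = j} =
            cyl A (cons i ω hij) (n + 1 + 1) := by
          ext ω'
          constructor
          · rintro ⟨h1, h2, -⟩ k hk
            cases k with
            | zero => exact h2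
            | succ k => exact h1 k (by omega)
          · intro h
            exact ⟨fun k hk => h (k + 1) (by omega), h 0 (by omega), (h 1 (by omega)).trans hj⟩
        have e2 : cyl A ω (n + 1) ∩ {ω | ω.1 0 = j} = cyl A ω (n + 1) :=
          Set.inter_eq_left.2 fun ω' h => (h 0 n.succ_pos).trans hj
        rw [e1, e2, hcyl, hcyl, Finset.prod_range_succ', ← hj]
        change (∏ k ∈ Finset.range n, ENNReal.ofReal (q (ω.1 k) (ω.1 (k + 1)))) *
          ENNReal.ofReal (q i (ω.1 0)) * ENNReal.ofReal (p (ω.1 n)) = _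
        ring
      · rw [hq.zero i j (hj ▸ hij), ENNReal.ofReal_zero, zero_mul]
        convert measure_empty (μ := μ)
        refine Set.eq_empty_of_forall_notMem ?_
        rintro ω' ⟨-, h2, h3⟩
        exact hij (by rw [hj, ← h2, ← h3]; exact ω'.2 0)
    · have e1 : shift A ⁻¹' cyl A ω (n + 1) ∩ {ω | ω.1 0 = i ∧ ω.1 1 = j} = ∅ :=
        Set.eq_empty_of_forall_notMem fun ω' h => hj ((h.1 0 n.succ_pos).symm.trans h.2.2)
      have e2 : cyl A ω (n + 1) ∩ {ω | ω.1 0 = j} = ∅ :=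
        Set.eq_empty_of_forall_notMem fun ω' h => hj ((h.1 0 n.succ_pos).symm.trans h.2)
      rw [e1, e2]
      simp
  have h := DFunLike.congr_fun heq D
  rw [Measure.map_apply measurable_shift hD, Measure.restrict_apply (measurable_shift hD),
    Measure.smul_apply, Measure.restrict_apply hD, smul_eq_mul] at h
  convert h using 2
  · ext ω; simp only [Set.mem_ofPred_eq, Set.mem_inter_iff, Set.mem_preimage]; tauto
  · congr 1; ext ω; simp only [Set.mem_ofPred_eq, Set.mem_inter_iff]; tauto

variable {q q' : Matrix (Fin N) (Fin N) ℝ} {μ ν : Measure (TMS A)}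

/-! ### Invariance, cylinder formula and ergodicity -/

theorem measureReal_eq_sum_coord [IsFiniteMeasure μ] (n : ℕ) {D : Set (TMS A)}
    (hD : MeasurableSet D) : μ.real D = ∑ j, μ.real {ω | ω.1 n = j ∧ ω ∈ D} := by
  have h : D = ⋃ j, {ω | ω.1 n = j ∧ ω ∈ D} := by ext; simp
  conv_lhs => rw [h]
  refine measureReal_iUnion_fintype (fun i j hij => ?_) fun j =>
    (measurable_coord n (measurableSet_singleton j)).inter hD
  exact Set.disjoint_left.2 fun ω h1 h2 => hij (h1.1.symm.trans h2.1)

theorem IsGMeasure.real_jac (hg : IsGMeasure q μ) (hq : IsGMatrix A q) (i j : Fin N)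
    {D : Set (TMS A)} (hD : MeasurableSet D) :
    μ.real {ω | ω.1 0 = i ∧ ω.1 1 = j ∧ shift A ω ∈ D} =
      q i j * μ.real {ω | ω.1 0 = j ∧ ω ∈ D} := by
  rw [measureReal_def, hg.jac i j D hD, ENNReal.toReal_mul, ENNReal.toReal_ofReal (hq.nonneg i j),
    measureReal_def]

theorem measurableSet_coord_and (n : ℕ) (j : Fin N) {D : Set (TMS A)} (hD : MeasurableSet D) :
    MeasurableSet {ω | ω.1 n = j ∧ ω ∈ D} :=
  (measurable_coord n (measurableSet_singleton j)).inter hD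

theorem IsGMeasure.real_preimage_shift (hg : IsGMeasure q μ) (hq : IsGMatrix A q) (i : Fin N)
    {D : Set (TMS A)} (hD : MeasurableSet D) :
    μ.real {ω | ω.1 0 = i ∧ shift A ω ∈ D} = ∑ j, q i j * μ.real {ω | ω.1 0 = j ∧ ω ∈ D} := by
  have := hg.prob
  refine (measureReal_eq_sum_coord 1 (measurableSet_coord_and 0 i (measurable_shift hD))).trans ?_
  refine Finset.sum_congr rfl fun j _ => ?_
  rw [← hg.real_jac hq i j hD]
  congr 1
  ext ω
  simp only [Set.mem_ofPred_eq, Set.mem_preimage]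
  tauto

theorem IsGMeasure.measurePreserving (hg : IsGMeasure q μ) (hq : IsGMatrix A q) :
    MeasurePreserving (shift A) μ μ := by
  have := hg.prob
  refine ⟨measurable_shift, Measure.ext fun D hD => ?_⟩
  rw [Measure.map_apply measurable_shift hD, ← measureReal_eq_measureReal_iff,
    measureReal_eq_sum_coord 0 (measurable_shift hD), measureReal_eq_sum_coord 0 hD]
  have h : ∀ i, μ.real {ω | ω.1 0 = i ∧ ω ∈ shift A ⁻¹' D} =
      ∑ j, q i j * μ.real {ω | ω.1 0 = j ∧ ω ∈ D} := fun i => hg.real_preimage_shift hq i hD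
  simp only [h]
  rw [Finset.sum_comm]
  exact Finset.sum_congr rfl fun j _ => by rw [← Finset.sum_mul, hq.sum, one_mul]

theorem measurable_shift_iterate (k : ℕ) : Measurable ((shift A)^[k]) :=
  measurable_shift.iterate k

theorem IsGMeasure.real_preimage_iterate (hg : IsGMeasure q μ) (hq : IsGMatrix A q) (k : ℕ)
    (i : Fin N) {D : Set (TMS A)} (hD : MeasurableSet D) :
    μ.real {ω | ω.1 0 = i ∧ (shift A)^[k] ω ∈ D} =
      ∑ j, (q ^ k) i j * μ.real {ω | ω.1 0 = j ∧ ω ∈ D} := by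
  induction k generalizing i with
  | zero => simp [Matrix.one_apply]
  | succ k ih =>
    have h := hg.real_preimage_shift hq i (D := (shift A)^[k] ⁻¹' D)
      (measurable_shift_iterate k hD)
    simp only [Set.mem_preimage, ih] at h
    simp only [Function.iterate_succ_apply, h, Finset.mul_sum, pow_succ', Matrix.mul_apply,
      Finset.sum_mul]
    rw [Finset.sum_comm]
    simp only [mul_assoc]

/-- Markov property: given the symbol at time `n`, the past and an event about the future from time
`n` on decouple. -/
theorem IsGMeasure.real_cyl_inter (hg : IsGMeasure q μ) (hq : IsGMatrix A q) (ω : TMS A) (n : ℕ)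
    {D : Set (TMS A)} (hD : MeasurableSet D) :
    μ.real (cyl A ω (n + 1) ∩ (shift A)^[n] ⁻¹' D) =
      (∏ k ∈ Finset.range n, q (ω.1 k) (ω.1 (k + 1))) * μ.real {ω' | ω'.1 0 = ω.1 n ∧ ω' ∈ D} := by
  induction n generalizing ω with
  | zero =>
    rw [Finset.range_zero, Finset.prod_empty, one_mul]
    congr 1
    ext ω'
    simp [cyl]
  | succ n ih =>
    have hE : MeasurableSet (cyl A (shift A ω) (n + 1) ∩ (shift A)^[n] ⁻¹' D) :=
      (measurableSet_cyl _ _).inter (measurable_shift_iterate n hD)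
    have e1 : cyl A ω (n + 1 + 1) ∩ (shift A)^[n + 1] ⁻¹' D = {ω' | ω'.1 0 = ω.1 0 ∧
        ω'.1 1 = ω.1 1 ∧ shift A ω' ∈ cyl A (shift A ω) (n + 1) ∩ (shift A)^[n] ⁻¹' D} := by
      ext ω'
      constructor
      · rintro ⟨h1, h2⟩
        exact ⟨h1 0 (by omega), h1 1 (by omega), fun k hk => h1 (k + 1) (by omega), h2⟩
      · rintro ⟨h1, -, h2, h3⟩
        refine ⟨fun k hk => ?_, h3⟩
        cases k with
        | zero => exact h1
        | succ k => exact h2 k (by omega)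
    have e2 : {ω' | ω'.1 0 = ω.1 1 ∧ ω' ∈ cyl A (shift A ω) (n + 1) ∩ (shift A)^[n] ⁻¹' D} =
        cyl A (shift A ω) (n + 1) ∩ (shift A)^[n] ⁻¹' D := by
      ext ω'
      exact ⟨fun h => h.2, fun h => ⟨h.1 0 n.succ_pos, h⟩⟩
    rw [e1, hg.real_jac hq _ _ hE, e2, ih, Finset.prod_range_succ']
    change _ * (_ * μ.real {ω' | ω'.1 0 = ω.1 (n + 1) ∧ ω' ∈ D}) = _
    change _ * ((∏ k ∈ Finset.range n, q (ω.1 (k + 1)) (ω.1 (k + 1 + 1))) * _) = _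
    ring

theorem IsGMeasure.real_cyl (hg : IsGMeasure q μ) (hq : IsGMatrix A q) (ω : TMS A) (n : ℕ) :
    μ.real (cyl A ω (n + 1)) =
      (∏ k ∈ Finset.range n, q (ω.1 k) (ω.1 (k + 1))) * μ.real {ω' | ω'.1 0 = ω.1 n} := by
  simpa using hg.real_cyl_inter hq ω n MeasurableSet.univ

theorem IsGMatrix.exists_le_pow (hq : IsGMatrix A q) (hA : IsZeroOne A) (hper : IsAperiodic A) :
    ∃ k, ∃ δ > 0, ∀ i j, δ ≤ (q ^ k) i j := by
  obtain ⟨k, -, hk⟩ := hq.exists_pow_pos hA hper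
  refine ⟨k, ?_⟩
  rcases isEmpty_or_nonempty (Fin N × Fin N) with h | h
  · exact ⟨1, one_pos, fun i j => isEmptyElim (i, j)⟩
  · obtain ⟨x, hx⟩ := Finite.exists_min fun x : Fin N × Fin N => (q ^ k) x.1 x.2
    exact ⟨_, hk x.1 x.2, fun i j => hx (i, j)⟩

theorem IsGMeasure.le_real_preimage_iterate (hg : IsGMeasure q μ) (hq : IsGMatrix A q) {k : ℕ}
    {δ : ℝ} (hδ : ∀ i j, δ ≤ (q ^ k) i j) (i : Fin N) {D : Set (TMS A)} (hD : MeasurableSet D) :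
    δ * μ.real D ≤ μ.real {ω | ω.1 0 = i ∧ (shift A)^[k] ω ∈ D} := by
  have := hg.prob
  rw [hg.real_preimage_iterate hq k i hD, measureReal_eq_sum_coord 0 hD, Finset.mul_sum]
  exact Finset.sum_le_sum fun j _ => mul_le_mul_of_nonneg_right (hδ i j) measureReal_nonneg

theorem IsGMeasure.real_symbol_pos (hg : IsGMeasure q μ) (hq : IsGMatrix A q) (hA : IsZeroOne A)
    (hper : IsAperiodic A) (i : Fin N) : 0 < μ.real {ω | ω.1 0 = i} := by
  have := hg.prob
  obtain ⟨k, δ, hδ0, hδ⟩ := hq.exists_le_pow hA hper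
  have h := hg.le_real_preimage_iterate hq hδ i MeasurableSet.univ
  simp only [probReal_univ, mul_one, Set.mem_univ, and_true] at h
  exact hδ0.trans_le h

theorem IsGMatrix.prod_pos (hq : IsGMatrix A q) (ω : TMS A) (n : ℕ) :
    0 < ∏ k ∈ Finset.range n, q (ω.1 k) (ω.1 (k + 1)) :=
  Finset.prod_pos fun k _ => hq.pos _ _ (ω.2 k)

/-- By the Markov property and the uniform lower bound `δ` on a power of `q`, an invariant set `E`
meets each cylinder in a proportion at least $\delta\mu(E)$. Thus $\delta\mu(E)\,\mu\le\mu|_E$, and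
evaluating at the complement of `E` shows that `E` or its complement is null. -/
theorem IsGMeasure.ergodic (hg : IsGMeasure q μ) (hq : IsGMatrix A q) (hA : IsZeroOne A)
    (hper : IsAperiodic A) : Ergodic (shift A) μ := by
  have := hg.prob
  refine ⟨hg.measurePreserving hq, ⟨fun E hE hinv => ?_⟩⟩
  obtain ⟨k, δ, hδ0, hδ⟩ := hq.exists_le_pow hA hper
  have hiter : ∀ m, (shift A)^[m] ⁻¹' E = E := fun m => by
    induction m with
    | zero => rfl
    | succ m ih => rw [Function.iterate_succ, Set.preimage_comp, ih, hinv]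
  have hmem : ∀ m ω, (shift A)^[m] ω ∈ E ↔ ω ∈ E := fun m ω => by
    rw [← Set.mem_preimage, hiter]
  have : IsFiniteMeasure (ENNReal.ofReal (δ * μ.real E) • μ) :=
    Measure.smul_finite _ ENNReal.ofReal_ne_top
  have hle : ENNReal.ofReal (δ * μ.real E) • μ ≤ μ.restrict E := by
    refine measure_le_of_cyl fun ω n => ?_
    have h1 := hg.real_cyl_inter hq ω n hE
    rw [hiter] at h1
    have h2 := hg.le_real_preimage_iterate hq hδ (ω.1 n) hE
    simp only [hmem] at h2
    have h3 : μ.real (cyl A ω (n + 1)) ≤ ∏ k ∈ Finset.range n, q (ω.1 k) (ω.1 (k + 1)) := by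
      rw [hg.real_cyl hq]
      exact mul_le_of_le_one_right (hq.prod_pos ω n).le measureReal_le_one
    rw [Measure.smul_apply, Measure.restrict_apply (measurableSet_cyl _ _), smul_eq_mul,
      ← ofReal_measureReal (s := cyl A ω (n + 1)), ← ENNReal.ofReal_mul (by positivity),
      ← ofReal_measureReal (s := cyl A ω (n + 1) ∩ E)]
    refine ENNReal.ofReal_le_ofReal ?_
    rw [h1, mul_comm]
    exact mul_le_mul h3 h2 (by positivity) (hq.prod_pos ω n).le
  have h0 := Measure.le_iff'.1 hle Eᶜ
  rw [Measure.restrict_apply hE.compl, Set.compl_inter_self, measure_empty, nonpos_iff_eq_zero,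
    Measure.smul_apply, smul_eq_mul, mul_eq_zero] at h0
  rw [Filter.eventuallyConst_set']
  rcases h0 with h0 | h0
  · left
    rw [ENNReal.ofReal_eq_zero] at h0
    have h4 : μ.real E ≤ 0 := by
      by_contra! h
      exact absurd h0 (not_le.2 (mul_pos hδ0 h))
    rw [ae_eq_empty]
    exact (measureReal_eq_zero_iff).1 (le_antisymm h4 measureReal_nonneg)
  · right
    exact ae_eq_univ.2 h0

/-! ### Identification and uniqueness of the Gibbs measure -/

/-- `q` is the matrix of the normalisation of `f`: up to a coboundary and a constant, `f` is the
logarithm of `q`. -/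
def IsCompatible (f : C(TMS A, ℝ)) (q : Matrix (Fin N) (Fin N) ℝ) : Prop :=
  ∃ (r : ℝ) (u : Fin N → ℝ), 0 < r ∧ (∀ i, 0 < u i) ∧
    ∀ ω : TMS A, u (ω.1 0) * Real.exp (f ω) = r * u (ω.1 1) * q (ω.1 0) (ω.1 1)

theorem IsGMeasure.isGibbs (hg : IsGMeasure q μ) (hq : IsGMatrix A q) (hA : IsZeroOne A)
    (hper : IsAperiodic A) {f : C(TMS A, ℝ)} (hf : IsCompatible f q) : IsGibbs A f μ := by
  obtain ⟨r, u, hr, hu, h⟩ := hf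
  refine ⟨hg.prob, hg.measurePreserving hq, ?_⟩
  have hS : ∀ (n : ℕ) (ω : TMS A), u (ω.1 0) * Real.exp (birkhoffSum (shift A) f n ω) =
      r ^ n * u (ω.1 n) * ∏ k ∈ Finset.range n, q (ω.1 k) (ω.1 (k + 1)) := by
    intro n ω
    induction n with
    | zero => simp
    | succ n ih =>
      have h1 := h ((shift A)^[n] ω)
      simp only [shift_iterate_apply, zero_add, add_comm 1 n] at h1
      rw [birkhoffSum_succ, Real.exp_add, ← mul_assoc, ih, Finset.prod_range_succ, pow_succ]
      linear_combination (r ^ n * ∏ k ∈ Finset.range n, q (ω.1 k) (ω.1 (k + 1))) * h1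
  -- The coboundary telescopes, so the Gibbs ratio depends only on three symbols and takes finitely
  -- many values. The factor `q` in the denominator appears because a cylinder of length $n+1$ has
  -- $n$ transitions while the Birkhoff sum has $n+1$ terms.
  let B : Fin N × Fin N × Fin N → ℝ := fun x =>
    μ.real {ω | ω.1 0 = x.1} * u x.2.2 / (u x.2.1 * q x.1 x.2.1)
  have hB : ∀ x, 0 ≤ B x := fun x => div_nonneg (mul_nonneg measureReal_nonneg (hu _).le)
    (mul_nonneg (hu _).le (hq.nonneg _ _))
  have hratio : ∀ (ω : TMS A) (n : ℕ), μ.real (cyl A ω (n + 1)) /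
      Real.exp (-((n + 1 : ℕ) : ℝ) * Real.log r + birkhoffSum (shift A) f (n + 1) ω) =
      B (ω.1 n, ω.1 (n + 1), ω.1 0) := by
    intro ω n
    have h1 := hS (n + 1) ω
    have h2 := (hq.prod_pos ω n).ne'
    have h3 := (hq.pos _ _ (ω.2 n)).ne'
    have h4 := (hu (ω.1 0)).ne'
    have h5 := (hu (ω.1 (n + 1))).ne'
    have h6 : Real.exp (birkhoffSum (shift A) f (n + 1) ω) = r ^ (n + 1) * u (ω.1 (n + 1)) *
        (∏ k ∈ Finset.range n, q (ω.1 k) (ω.1 (k + 1))) * q (ω.1 n) (ω.1 (n + 1)) / u (ω.1 0) := by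
      rw [eq_div_iff h4, mul_comm, h1, Finset.prod_range_succ]
      ring
    rw [Real.exp_add, h6, neg_mul, Real.exp_neg, mul_comm (_ : ℝ) (Real.log r), Real.exp_mul,
      Real.exp_log hr, Real.rpow_natCast, hg.real_cyl hq]
    simp only [B]
    field_simp
  have hBpos : ∀ (ω : TMS A) (n : ℕ), 0 < B (ω.1 n, ω.1 (n + 1), ω.1 0) := fun ω n =>
    div_pos (mul_pos (hg.real_symbol_pos hq hA hper _) (hu _))
      (mul_pos (hu _) (hq.pos _ _ (ω.2 n)))
  set C := 1 + ∑ x, (B x + (B x)⁻¹) with hC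
  have hnn : ∀ x, 0 ≤ B x + (B x)⁻¹ := fun x => add_nonneg (hB x) (inv_nonneg.2 (hB x))
  have hC0 : 0 < C := add_pos_of_pos_of_nonneg one_pos (Finset.sum_nonneg fun x _ => hnn x)
  have hCle : ∀ x, B x + (B x)⁻¹ ≤ C := fun x =>
    (Finset.single_le_sum (fun x _ => hnn x) (Finset.mem_univ x)).trans (by rw [hC]; linarith)
  refine ⟨C, hC0, Real.log r, fun ω n hn => ?_⟩
  obtain ⟨n, rfl⟩ := Nat.exists_eq_succ_of_ne_zero (Nat.one_le_iff_ne_zero.1 hn)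
  rw [Nat.succ_eq_add_one, hratio]
  set x := (ω.1 n, ω.1 (n + 1), ω.1 0)
  have h1 := hCle x
  have h2 := hBpos ω n
  have h3 : 0 < (B x)⁻¹ := inv_pos.2 h2
  exact ⟨inv_le_of_inv_le₀ h2 (by linarith), by linarith⟩

/-- Dividing the two Gibbs bounds leaves $e^{(n+1)(P'-P)}$. With the roles exchanged, a negative
rate would make the total mass tend to zero, so the sign of $s=P'-P$ is as claimed. -/
theorem IsGibbs.exists_cyl_le {f : C(TMS A, ℝ)} (hμ : IsGibbs A f μ) (hν : IsGibbs A f ν) :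
    ∃ (K s : ℝ), 0 ≤ K ∧ s ≤ 0 ∧ ∀ ω n, μ.real (cyl A ω (n + 1)) ≤
      K * Real.exp (((n + 1 : ℕ) : ℝ) * s) * ν.real (cyl A ω (n + 1)) := by
  have hkey : ∀ {μ ν : Measure (TMS A)} [IsProbabilityMeasure μ] [IsProbabilityMeasure ν]
      (K s : ℝ), 0 ≤ K → (∀ ω n, μ.real (cyl A ω (n + 1)) ≤
      K * Real.exp (((n + 1 : ℕ) : ℝ) * s) * ν.real (cyl A ω (n + 1))) → 0 ≤ s := by
    intro μ ν _ _ K s hK h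
    by_contra! hs
    have hlim : Filter.Tendsto (fun n : ℕ => K * Real.exp (((n + 1 : ℕ) : ℝ) * s))
        Filter.atTop (nhds (K * 0)) := by
      refine Filter.Tendsto.const_mul K (Real.tendsto_exp_atBot.comp ?_)
      exact ((tendsto_natCast_atTop_atTop (R := ℝ)).comp
        (Filter.tendsto_add_atTop_nat 1)).atTop_mul_const_of_neg hs
    rw [mul_zero] at hlim
    obtain ⟨n, hn⟩ := (hlim.eventually (gt_mem_nhds one_pos)).exists
    have h1 := measure_word_preimage_le (μ := μ) (n := n + 1)
      (ν := ENNReal.ofReal (K * Real.exp (((n + 1 : ℕ) : ℝ) * s)) • ν) (fun ω => by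
        rw [Measure.smul_apply, smul_eq_mul, ← ofReal_measureReal (μ := μ),
          ← ofReal_measureReal (μ := ν), ← ENNReal.ofReal_mul (by positivity)]
        exact ENNReal.ofReal_le_ofReal (h ω n)) Set.univ
    rw [Set.preimage_univ, Measure.smul_apply, measure_univ, measure_univ, smul_eq_mul, mul_one,
      ENNReal.one_le_ofReal] at h1
    linarith
  have hle : ∀ {μ ν : Measure (TMS A)} {C P C' P' : ℝ}, 0 < C → 0 < C' →
      (∀ (ω : TMS A) (n : ℕ), 1 ≤ n →
        C⁻¹ ≤ μ.real (cyl A ω n) / Real.exp (-(n : ℝ) * P + birkhoffSum (shift A) f n ω) ∧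
        μ.real (cyl A ω n) / Real.exp (-(n : ℝ) * P + birkhoffSum (shift A) f n ω) ≤ C) →
      (∀ (ω : TMS A) (n : ℕ), 1 ≤ n →
        C'⁻¹ ≤ ν.real (cyl A ω n) / Real.exp (-(n : ℝ) * P' + birkhoffSum (shift A) f n ω) ∧
        ν.real (cyl A ω n) / Real.exp (-(n : ℝ) * P' + birkhoffSum (shift A) f n ω) ≤ C') →
      ∀ ω n, μ.real (cyl A ω (n + 1)) ≤
        C * C' * Real.exp (((n + 1 : ℕ) : ℝ) * (P' - P)) * ν.real (cyl A ω (n + 1)) := by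
    intro μ ν C P C' P' hC hC' h h' ω n
    have h1 := (h ω (n + 1) (by omega)).2
    have h2 := (h' ω (n + 1) (by omega)).1
    rw [div_le_iff₀ (Real.exp_pos _)] at h1
    rw [le_div_iff₀ (Real.exp_pos _), inv_mul_le_iff₀ hC'] at h2
    refine h1.trans ?_
    have h3 : Real.exp (-((n + 1 : ℕ) : ℝ) * P + birkhoffSum (shift A) f (n + 1) ω) =
        Real.exp (((n + 1 : ℕ) : ℝ) * (P' - P)) *
        Real.exp (-((n + 1 : ℕ) : ℝ) * P' + birkhoffSum (shift A) f (n + 1) ω) := by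
      rw [← Real.exp_add]; ring_nf
    rw [h3]
    calc C * (Real.exp (((n + 1 : ℕ) : ℝ) * (P' - P)) *
          Real.exp (-((n + 1 : ℕ) : ℝ) * P' + birkhoffSum (shift A) f (n + 1) ω))
        ≤ C * (Real.exp (((n + 1 : ℕ) : ℝ) * (P' - P)) * (C' * ν.real (cyl A ω (n + 1)))) := by
          gcongr
      _ = _ := by ring
  have := hμ.prob
  have := hν.prob
  obtain ⟨C, hC, P, h⟩ := hμ.bound
  obtain ⟨C', hC', P', h'⟩ := hν.bound
  have h1 := hkey _ _ (by positivity) (hle hC' hC h' h)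
  exact ⟨C * C', P' - P, by positivity, by linarith, hle hC hC' h h'⟩

/-- The cylinder comparison gives $\mu\le K\nu$, and an invariant probability measure absolutely
continuous with respect to an ergodic one equals it. -/
theorem IsGMeasure.eq_of_isGibbs (hg : IsGMeasure q ν) (hq : IsGMatrix A q) (hA : IsZeroOne A)
    (hper : IsAperiodic A) {f : C(TMS A, ℝ)} (hf : IsCompatible f q) (hμ : IsGibbs A f μ) :
    μ = ν := by
  have := hμ.prob
  have := hg.prob
  obtain ⟨K, s, hK, hs, h⟩ := hμ.exists_cyl_le (hg.isGibbs hq hA hper hf)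
  have : IsFiniteMeasure (ENNReal.ofReal K • ν) := Measure.smul_finite _ ENNReal.ofReal_ne_top
  have hle : μ ≤ ENNReal.ofReal K • ν := by
    refine measure_le_of_cyl fun ω n => ?_
    rw [Measure.smul_apply, smul_eq_mul, ← ofReal_measureReal (μ := μ),
      ← ofReal_measureReal (μ := ν), ← ENNReal.ofReal_mul hK]
    refine ENNReal.ofReal_le_ofReal ((h ω n).trans ?_)
    refine mul_le_mul_of_nonneg_right (mul_le_of_le_one_right hK ?_) measureReal_nonneg
    exact Real.exp_le_one_iff.2 (mul_nonpos_of_nonneg_of_nonpos (Nat.cast_nonneg _) hs)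
  exact (hg.ergodic hq hA hper).eq_of_absolutelyContinuous hμ.invariant
    (Measure.absolutelyContinuous_of_le_smul hle)

/-- `gibbs` is merely some choice of Gibbs measure; uniqueness is what identifies it with the
measure constructed from `q`. -/
theorem isGMeasure_gibbs (hN : 2 ≤ N) (hA : IsZeroOne A) (hper : IsAperiodic A)
    (hq : IsGMatrix A q) {f : C(TMS A, ℝ)} (hf : IsCompatible f q) :
    IsGMeasure q (gibbs A f) := by
  obtain ⟨ν, hν⟩ := hq.exists_isGMeasure hN hA hper
  have h : IsGibbs A f (gibbs A f) := Classical.epsilon_spec ⟨ν, hν.isGibbs hq hA hper hf⟩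
  rwa [hν.eq_of_isGibbs hq hA hper hf h]

theorem IsGMeasure.matrix_unique {q' : Matrix (Fin N) (Fin N) ℝ} (hg : IsGMeasure q μ)
    (hg' : IsGMeasure q' μ) (hq : IsGMatrix A q) (hq' : IsGMatrix A q') (hA : IsZeroOne A)
    (hper : IsAperiodic A) : q = q' := by
  ext i j
  have h := hg.real_jac hq i j MeasurableSet.univ
  rw [hg'.real_jac hq' i j MeasurableSet.univ] at h
  simp only [Set.mem_univ, and_true] at h
  exact (mul_right_cancel₀ (hg.real_symbol_pos hq hA hper j).ne' h).symm

/-! ### Branching transitions and the code -/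

/-- The allowed transitions into symbols with at least two predecessors. -/
def branching (A : Matrix (Fin N) (Fin N) ℕ) : Set (Fin N × Fin N) :=
  {e | A e.1 e.2 = 1 ∧ ∃ i, i ≠ e.1 ∧ A i e.2 = 1}

/-- `q` takes different values at different branching transitions. -/
def IsSeparating (A : Matrix (Fin N) (Fin N) ℕ) (q : Matrix (Fin N) (Fin N) ℝ) : Prop :=
  (branching A).InjOn fun e => q e.1 e.2

theorem IsGMatrix.lt_one (hq : IsGMatrix A q) {e : Fin N × Fin N} (he : e ∈ branching A) :
    q e.1 e.2 < 1 := by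
  obtain ⟨-, i, hi, hA⟩ := he
  rw [← hq.sum e.2, ← Finset.add_sum_erase _ _ (Finset.mem_univ e.1)]
  exact lt_add_of_pos_right _ (Finset.sum_pos' (fun _ _ => hq.nonneg _ _)
    ⟨i, Finset.mem_erase.2 ⟨hi, Finset.mem_univ _⟩, hq.pos _ _ hA⟩)

theorem IsGMatrix.eq_one (hq : IsGMatrix A q) {i j : Fin N} (h : A i j = 1)
    (he : (i, j) ∉ branching A) : q i j = 1 := by
  rw [← hq.sum j]
  refine (Finset.sum_eq_single i (fun l _ hl => hq.zero l j fun hA => he ⟨h, l, hl, hA⟩)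
    (by simp)).symm

theorem IsGMatrix.lt_one_iff (hq : IsGMatrix A q) {i j : Fin N} (h : A i j = 1) :
    q i j < 1 ↔ (i, j) ∈ branching A :=
  ⟨fun hlt => by_contra fun he => hlt.ne (hq.eq_one h he), fun he => hq.lt_one he⟩

/-- Otherwise every symbol from time $n+1$ on has a single predecessor, so each `ω.1 (n + k)` is
reached in `k` steps from `ω.1 n` only. Aperiodicity makes it reachable from two different symbols.
-/
theorem exists_branching (hN : 2 ≤ N) (hA : IsZeroOne A) (hper : IsAperiodic A) (ω : TMS A)
    (n : ℕ) : ∃ m ≥ n, (ω.1 m, ω.1 (m + 1)) ∈ branching A := by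
  by_contra! hno
  have huniq : ∀ m ≥ n, ∀ i, A i (ω.1 (m + 1)) = 1 → i = ω.1 m := fun m hm i hi =>
    by_contra fun hne => hno m hm ⟨ω.2 m, i, hne, hi⟩
  have hpow : ∀ k i, 0 < (A ^ k) i (ω.1 (n + k)) → i = ω.1 n := by
    intro k
    induction k with
    | zero =>
      intro i hi
      by_contra hne
      simp [Matrix.one_apply_ne hne] at hi
    | succ k ih =>
      intro i hi
      rw [pow_succ, Matrix.mul_apply] at hi
      obtain ⟨l, -, hl⟩ := Finset.exists_ne_zero_of_sum_ne_zero hi.ne'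
      have hl' := mul_ne_zero_iff.1 hl
      obtain rfl := huniq (n + k) (by omega) l ((hA _ _).resolve_left hl'.2)
      exact ih i (Nat.pos_of_ne_zero hl'.1)
  obtain ⟨k, -, hk⟩ := hper
  have h0 := hpow k ⟨0, by omega⟩ (hk _ _)
  have h1 := hpow k ⟨1, by omega⟩ (hk _ _)
  simpa using h0.trans h1.symm

/-- The sequence of conditional probabilities along an orbit. -/
def code (q : Matrix (Fin N) (Fin N) ℝ) (ω : TMS A) : ℕ → ℝ := fun n => q (ω.1 n) (ω.1 (n + 1))

theorem continuous_code (q : Matrix (Fin N) (Fin N) ℝ) : Continuous (code q : TMS A → _) :=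
  continuous_pi fun n =>
    (continuous_of_discreteTopology (f := fun x : Fin N × Fin N => q x.1 x.2)).comp
      ((continuous_coord n).prodMk (continuous_coord (n + 1)))

/-- Values below $1$ mark the branching transitions and identify them. Some branching transition
occurs beyond any time `n`, and agreement there propagates backwards: two different predecessors of
one symbol would give two branching transitions with the same value. -/
theorem code_injective (hN : 2 ≤ N) (hA : IsZeroOne A) (hper : IsAperiodic A)
    (hq : IsGMatrix A q) (hs : IsSeparating A q) : Function.Injective (code q : TMS A → _) := by
  intro ω ω' h
  have hedge : ∀ m, (ω.1 m, ω.1 (m + 1)) ∈ branching A → ω.1 m = ω'.1 m := by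
    intro m hm
    have hm' : (ω'.1 m, ω'.1 (m + 1)) ∈ branching A := by
      rw [← hq.lt_one_iff (ω'.2 m)]
      exact (congrFun h m).symm.trans_lt (hq.lt_one hm)
    exact congrArg Prod.fst (hs hm hm' (congrFun h m))
  have hback : ∀ m, ω.1 (m + 1) = ω'.1 (m + 1) → ω.1 m = ω'.1 m := by
    intro m hm
    by_contra hne
    exact hne (hedge m ⟨ω.2 m, ω'.1 m, Ne.symm hne, by rw [hm]; exact ω'.2 m⟩)
  refine Subtype.ext (funext fun n => ?_)
  obtain ⟨m, hm, hb⟩ := exists_branching hN hA hper ω n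
  obtain ⟨d, rfl⟩ := Nat.exists_eq_add_of_le hm
  have h0 := hedge _ hb
  clear hb hm
  induction d with
  | zero => exact h0
  | succ d ih => exact ih (hback (n + d) h0)

/-! ### From isomorphism to equivalence -/

/-- The shift is injective on points with the same first symbol, so images of Borel sets are Borel
(Lusin-Souslin) and `jac` can be read as a formula for the measure of an image. -/
theorem IsGMeasure.measure_image_shift (hg : IsGMeasure q μ) {i j : Fin N} {s : Set (TMS A)}
    (hs : MeasurableSet s) (hij : ∀ ω ∈ s, ω.1 0 = i ∧ ω.1 1 = j) :
    MeasurableSet (shift A '' s) ∧ μ s = ENNReal.ofReal (q i j) * μ (shift A '' s) := by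
  have hinj : ∀ ω ω' : TMS A, ω.1 0 = ω'.1 0 → shift A ω = shift A ω' → ω = ω' := by
    intro ω ω' h0 h
    refine Subtype.ext (funext fun n => ?_)
    cases n with
    | zero => exact h0
    | succ n => exact congrFun (congrArg Subtype.val h) n
  have hm : MeasurableSet (shift A '' s) :=
    hs.image_of_continuousOn_injOn continuous_shift.continuousOn fun ω hω ω' hω' h =>
      hinj ω ω' ((hij ω hω).1.trans (hij ω' hω').1.symm) h
  refine ⟨hm, ?_⟩
  have e1 : {ω | ω.1 0 = i ∧ ω.1 1 = j ∧ shift A ω ∈ shift A '' s} = s := by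
    ext ω
    constructor
    · rintro ⟨h0, -, ω', hω', h⟩
      rwa [hinj ω ω' (h0.trans (hij ω' hω').1.symm) h.symm]
    · exact fun h => ⟨(hij ω h).1, (hij ω h).2, ω, h, rfl⟩
  have e2 : {ω | ω.1 0 = j ∧ ω ∈ shift A '' s} = shift A '' s := by
    ext ω
    refine ⟨fun h => h.2, fun h => ⟨?_, h⟩⟩
    obtain ⟨ω', hω', rfl⟩ := h
    exact (hij ω' hω').2
  have h := hg.jac i j _ hm
  rwa [e1, e2] at h

/-- An isomorphism transports the conditional probabilities. -/
theorem measure_jac_ne_eq_zero (hg : IsGMeasure q μ) (hg' : IsGMeasure q' ν) (hq : IsGMatrix A q)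
    (hq' : IsGMatrix A q') {X Y : Set (TMS A)} (hX : ∀ ω ∈ X, shift A ω ∈ X) (Φ : X ≃ᵐ Y)
    (hXm : MeasurableSet X) (hYm : MeasurableSet Y)
    (hcomm : ∀ ω : X, (Φ ⟨shift A ω.1, hX ω.1 ω.2⟩ : TMS A) = shift A (Φ ω))
    (hmeas : ∀ B : Set X, MeasurableSet B → μ (Subtype.val '' B) = ν (Subtype.val '' (Φ '' B))) :
    μ (Subtype.val '' {x : X | code q x.1 0 ≠ code q' (Φ x).1 0}) = 0 := by
  have := hg.prob
  -- Finitely many pieces cover the exceptional set, each fixing a transition on either side with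
  -- different values. On a piece $B$, $\mu(B)=q\,\mu(\sigma B)$ and $\nu(\Phi B)=q'\,\nu(\Phi\sigma
  -- B)$, so positive measure would force $q=q'$.
  have hsub : Subtype.val '' {x : X | code q x.1 0 ≠ code q' (Φ x).1 0} ⊆
      ⋃ (a : {a : (Fin N × Fin N) × (Fin N × Fin N) // q a.1.1 a.1.2 ≠ q' a.2.1 a.2.2}),
        Subtype.val '' {x : X | (x.1.1 0 = a.1.1.1 ∧ x.1.1 1 = a.1.1.2) ∧
          ((Φ x).1.1 0 = a.1.2.1 ∧ (Φ x).1.1 1 = a.1.2.2)} := by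
    rintro _ ⟨x, hx, rfl⟩
    exact Set.mem_iUnion.2 ⟨⟨((x.1.1 0, x.1.1 1), ((Φ x).1.1 0, (Φ x).1.1 1)), hx⟩, x,
      ⟨⟨rfl, rfl⟩, rfl, rfl⟩, rfl⟩
  refine measure_mono_null hsub (measure_iUnion_null ?_)
  rintro ⟨⟨⟨i, i'⟩, j, j'⟩, hne⟩
  simp only at hne ⊢
  set B : Set X := {x : X | (x.1.1 0 = i ∧ x.1.1 1 = i') ∧ ((Φ x).1.1 0 = j ∧ (Φ x).1.1 1 = j')}
    with hB
  have hco : ∀ k, Measurable fun x : X => x.1.1 k := fun k =>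
    (measurable_coord k).comp measurable_subtype_coe
  have hco' : ∀ k, Measurable fun x : X => (Φ x).1.1 k := fun k =>
    (measurable_coord k).comp (measurable_subtype_coe.comp Φ.measurable)
  have hBm : MeasurableSet B :=
    ((hco 0 (measurableSet_singleton i)).inter (hco 1 (measurableSet_singleton i'))).inter
      ((hco' 0 (measurableSet_singleton j)).inter (hco' 1 (measurableSet_singleton j')))
  obtain ⟨hD, h1⟩ := hg.measure_image_shift (i := i) (j := i') (hXm.subtype_image hBm) (by
    rintro _ ⟨x, hx, rfl⟩; exact hx.1)
  obtain ⟨-, h2⟩ := hg'.measure_image_shift (i := j) (j := j')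
    (hYm.subtype_image ((MeasurableEquiv.measurableSet_image Φ).2 hBm)) (by
    rintro _ ⟨_, ⟨x, hx, rfl⟩, rfl⟩; exact hx.2)
  have h3 := hmeas (Subtype.val ⁻¹' (shift A '' (Subtype.val '' B)))
    (measurable_subtype_coe hD)
  have e1 : Subtype.val '' (Subtype.val ⁻¹' (shift A '' (Subtype.val '' B)) : Set X) =
      shift A '' (Subtype.val '' B) := by
    rw [Subtype.image_preimage_coe, Set.inter_eq_right]
    rintro _ ⟨_, ⟨x, -, rfl⟩, rfl⟩
    exact hX x.1 x.2
  have e2 : Subtype.val '' (Φ '' (Subtype.val ⁻¹' (shift A '' (Subtype.val '' B)) : Set X)) =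
      shift A '' (Subtype.val '' (Φ '' B)) := by
    ext ω
    constructor
    · rintro ⟨_, ⟨y, ⟨_, ⟨x, hx, rfl⟩, hy⟩, rfl⟩, rfl⟩
      refine ⟨_, ⟨_, ⟨x, hx, rfl⟩, rfl⟩, ?_⟩
      rw [← hcomm]
      exact congrArg (fun z => (Φ z).1) (Subtype.ext hy)
    · rintro ⟨_, ⟨_, ⟨x, hx, rfl⟩, rfl⟩, rfl⟩
      exact ⟨_, ⟨⟨shift A x.1, hX x.1 x.2⟩, ⟨_, ⟨x, hx, rfl⟩, rfl⟩, rfl⟩, hcomm x⟩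
  rw [e1, e2] at h3
  rw [← hmeas B hBm, ← h3, h1] at h2
  rw [h1]
  by_contra h0
  have hD0 : μ (shift A '' (Subtype.val '' B)) ≠ 0 := right_ne_zero_of_mul h0
  rw [ENNReal.mul_left_inj hD0 (measure_ne_top _ _),
    ENNReal.ofReal_eq_ofReal_iff (hq.nonneg _ _) (hq'.nonneg _ _)] at h2
  exact hne h2

theorem measure_code_preimage_eq (hg : IsGMeasure q μ) (hg' : IsGMeasure q' ν)
    (hq : IsGMatrix A q) (hq' : IsGMatrix A q') (hiso : AreIsomorphic A μ ν) {S : Set (ℕ → ℝ)}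
    (hS : MeasurableSet S) : μ (code q ⁻¹' S) = ν (code q' ⁻¹' S) := by
  obtain ⟨X, Y, hX, -, Φ, hXm, hYm, hμX, hνY, hcomm, hmeas⟩ := hiso
  have := hg.prob
  have := hg'.prob
  have hbad := measure_jac_ne_eq_zero hg hg' hq hq' hX Φ hXm hYm hcomm hmeas
  set bad := Subtype.val '' {x : X | code q x.1 0 ≠ code q' (Φ x).1 0}
  -- By invariance almost every orbit avoids the exceptional set forever; on such orbits the whole
  -- codes agree, not only their first entries.
  have hcode : ∀ᵐ ω ∂μ, ∀ n, (shift A)^[n] ω ∉ bad := by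
    rw [ae_all_iff]
    intro n
    exact measure_eq_zero_iff_ae_notMem.1
      (((hg.measurePreserving hq).iterate n).quasiMeasurePreserving.preimage_null hbad)
  have hiter : ∀ (n : ℕ) (x : X), ∃ y : X, y.1 = (shift A)^[n] x.1 ∧
      (Φ y).1 = (shift A)^[n] (Φ x).1 := by
    intro n
    induction n with
    | zero => exact fun x => ⟨x, rfl, rfl⟩
    | succ n ih =>
      intro x
      obtain ⟨y, h1, h2⟩ := ih ⟨shift A x.1, hX x.1 x.2⟩
      exact ⟨y, h1, by rw [h2, hcomm]; rfl⟩
  have heq : ∀ x : X, (∀ n, (shift A)^[n] x.1 ∉ bad) → code q x.1 = code q' (Φ x).1 := by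
    intro x hx
    funext n
    by_contra hne
    obtain ⟨y, h1, h2⟩ := hiter n x
    refine hx n ⟨y, fun h => hne ?_, h1⟩
    rw [h1, h2] at h
    simpa [code, shift_iterate_apply, add_comm 1 n] using h
  have hXae : ∀ᵐ ω ∂μ, ω ∈ X := by
    rw [← prob_compl_eq_zero_iff hXm] at hμX
    exact hμX
  have hYae : ∀ᵐ ω ∂ν, ω ∈ Y := by
    rw [← prob_compl_eq_zero_iff hYm] at hνY
    exact hνY
  have hP : MeasurableSet {x : X | code q' (Φ x).1 ∈ S} :=
    ((continuous_code q').measurable.comp (measurable_subtype_coe.comp Φ.measurable)) hS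
  calc μ (code q ⁻¹' S) = μ (Subtype.val '' {x : X | code q' (Φ x).1 ∈ S}) := by
        refine measure_congr ?_
        filter_upwards [hcode, hXae] with ω h1 h2
        refine propext ⟨fun h => ⟨⟨ω, h2⟩, ?_, rfl⟩, ?_⟩
        · change code q' (Φ ⟨ω, h2⟩).1 ∈ S
          rw [← heq ⟨ω, h2⟩ h1]
          exact h
        · rintro ⟨x, hx, rfl⟩
          change code q x.1 ∈ S
          rw [heq x h1]
          exact hx
    _ = ν (Subtype.val '' (Φ '' {x : X | code q' (Φ x).1 ∈ S})) := hmeas _ hP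
    _ = ν (code q' ⁻¹' S) := by
        refine measure_congr ?_
        filter_upwards [hYae] with ω h
        refine propext ⟨?_, fun h' => ⟨⟨ω, h⟩, ⟨Φ.symm ⟨ω, h⟩, ?_, by simp⟩, rfl⟩⟩
        · rintro ⟨_, ⟨x, hx, rfl⟩, rfl⟩
          exact hx
        · change code q' (Φ (Φ.symm ⟨ω, h⟩)).1 ∈ S
          rw [MeasurableEquiv.apply_symm_apply]
          exact h'

/-- Every cylinder has positive `μ`-measure, so every finite initial block of a `q`-code has
positive probability under `ν` and hence occurs among `q'`-codes. Compactness of the range passes to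
infinite codes. -/
theorem range_code_subset (hA : IsZeroOne A) (hper : IsAperiodic A) (hg : IsGMeasure q μ)
    (hq : IsGMatrix A q)
    (h : ∀ S : Set (ℕ → ℝ), MeasurableSet S → μ (code q ⁻¹' S) = ν (code q' ⁻¹' S)) :
    Set.range (code q : TMS A → _) ⊆ Set.range (code q' : TMS A → _) := by
  have := hg.prob
  rintro _ ⟨ω, rfl⟩
  have hne : ∀ n, ∃ ω' : TMS A, ∀ k < n, code q' ω' k = code q ω k := by
    intro n
    have hS : MeasurableSet {y : ℕ → ℝ | ∀ k < n, y k = code q ω k} := by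
      simp only [Set.ofPred_forall]
      exact MeasurableSet.iInter fun k => MeasurableSet.iInter fun _ =>
        measurable_pi_apply k (measurableSet_singleton _)
    have hpos : 0 < μ.real (cyl A ω (n + 1)) := by
      rw [hg.real_cyl hq]
      exact mul_pos (hq.prod_pos ω n) (hg.real_symbol_pos hq hA hper _)
    have hsub : cyl A ω (n + 1) ⊆ code q ⁻¹' {y | ∀ k < n, y k = code q ω k} := by
      intro ω' hω' k hk
      simp only [code, hω' k (by omega), hω' (k + 1) (by omega)]
    have hpos' : ν (code q' ⁻¹' {y | ∀ k < n, y k = code q ω k}) ≠ 0 := by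
      rw [← h _ hS]
      intro h0
      exact hpos.ne' ((measureReal_eq_zero_iff).2 (measure_mono_null hsub h0))
    exact nonempty_of_measure_ne_zero hpos'
  choose u hu using hne
  refine (isCompact_range (continuous_code q')).isClosed.mem_of_tendsto
    (b := Filter.atTop) (f := fun n => code q' (u n)) ?_
    (Filter.Eventually.of_forall fun n => ⟨u n, rfl⟩)
  rw [tendsto_pi_nhds]
  intro k
  refine tendsto_const_nhds.congr' ?_
  filter_upwards [Filter.eventually_gt_atTop k] with n hn
  exact (hu n k hn).symm

/-- Counting: the values below $1$ of `q` occur among those of `q'`, and `q` already has as many as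
there are branching transitions. -/
theorem IsSeparating.of_range_code_subset (hA : IsZeroOne A) (hper : IsAperiodic A)
    (hq : IsGMatrix A q) (hq' : IsGMatrix A q') (hs : IsSeparating A q)
    (h : Set.range (code q : TMS A → _) ⊆ Set.range (code q' : TMS A → _)) :
    IsSeparating A q' := by
  have hfin := Set.toFinite (branching A)
  have hsub : (fun e : Fin N × Fin N => q e.1 e.2) '' branching A ⊆
      (fun e : Fin N × Fin N => q' e.1 e.2) '' branching A := by
    rintro _ ⟨e, he, rfl⟩
    obtain ⟨ω, h0, h1⟩ := exists_point_edge hA hper he.1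
    obtain ⟨ω', hω'⟩ := h ⟨ω, rfl⟩
    have h2 : q' (ω'.1 0) (ω'.1 1) = q e.1 e.2 := by
      rw [← h0, ← h1]
      exact congrFun hω' 0
    exact ⟨(ω'.1 0, ω'.1 1), (hq'.lt_one_iff (ω'.2 0)).1 (h2.trans_lt (hq.lt_one he)), h2⟩
  have h1 := Set.ncard_le_ncard hsub (Set.toFinite _)
  rw [hs.ncard_image] at h1
  exact (Set.ncard_image_iff hfin).1 (le_antisymm (Set.ncard_image_le hfin) h1)

theorem areEquivalent_of_areIsomorphic (hN : 2 ≤ N) (hA : IsZeroOne A) (hper : IsAperiodic A)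
    (hg : IsGMeasure q μ) (hg' : IsGMeasure q' ν) (hq : IsGMatrix A q) (hq' : IsGMatrix A q')
    (hs : IsSeparating A q) (hiso : AreIsomorphic A μ ν) : AreEquivalent A μ ν := by
  have h : ∀ S : Set (ℕ → ℝ), MeasurableSet S → μ (code q ⁻¹' S) = ν (code q' ⁻¹' S) :=
    fun S hS => measure_code_preimage_eq hg hg' hq hq' hiso hS
  have hr1 := range_code_subset hA hper hg hq h
  have hr2 := range_code_subset hA hper hg' hq' fun S hS => (h S hS).symm
  have hs' := hs.of_range_code_subset hA hper hq hq' hr1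
  have hi := code_injective hN hA hper hq hs
  have hi' := code_injective hN hA hper hq' hs'
  have hc := (continuous_code (A := A) q).isClosedEmbedding hi
  have hc' := (continuous_code (A := A) q').isClosedEmbedding hi'
  -- Characterised by `code q' (τ ω) = code q ω`. Codes turn the shift into deletion of the first
  -- entry, so `τ` commutes with it.
  let τ : TMS A ≃ₜ TMS A := hc.isEmbedding.toHomeomorph.trans
    ((Homeomorph.setCongr (hr1.antisymm hr2)).trans hc'.isEmbedding.toHomeomorph.symm)
  have hτ : ∀ ω, code q' (τ ω) = code q ω := fun ω =>
    congrArg Subtype.val (hc'.isEmbedding.toHomeomorph.apply_symm_apply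
      (Homeomorph.setCongr (hr1.antisymm hr2) (hc.isEmbedding.toHomeomorph ω)))
  refine ⟨τ, fun ω => hi' ?_, fun B hB => ?_⟩
  · rw [hτ]
    exact funext fun n => (congrFun (hτ ω) (n + 1)).symm
  · have h1 := h _ (hc.measurableEmbedding.measurableSet_image.2 hB)
    rw [hi.preimage_image] at h1
    rw [h1]
    congr 1
    ext ω
    constructor
    · rintro ⟨ω', hω', h2⟩
      exact ⟨ω', hω', hi' ((hτ ω').trans h2)⟩
    · rintro ⟨ω', hω', rfl⟩
      exact ⟨ω', hω', (hτ ω').symm⟩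

theorem AreEquivalent.areIsomorphic [IsProbabilityMeasure μ] [IsProbabilityMeasure ν]
    (h : AreEquivalent A μ ν) : AreIsomorphic A μ ν := by
  obtain ⟨τ, hcomm, hmeas⟩ := h
  let Φ : (Set.univ : Set (TMS A)) ≃ᵐ (Set.univ : Set (TMS A)) :=
    (MeasurableEquiv.Set.univ _).trans (τ.toMeasurableEquiv.trans (MeasurableEquiv.Set.univ _).symm)
  have hΦ : ∀ x, (Φ x).1 = τ x.1 := fun x => rfl
  refine ⟨Set.univ, Set.univ, fun _ _ => trivial, fun _ _ => trivial, Φ, .univ, .univ,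
    measure_univ, measure_univ, fun ω => ?_, fun B hB => ?_⟩
  · rw [hΦ, hΦ]
    exact hcomm _
  · rw [hmeas _ (MeasurableSet.univ.subtype_image hB)]
    congr 1
    rw [Set.image_image, Set.image_image]
    rfl

/-! ### Normalisation of functions of two coordinates -/

open Classical in
/-- The transfer matrix of a function that depends on the first two coordinates. -/
noncomputable def transfer (A : Matrix (Fin N) (Fin N) ℕ) (f : C(TMS A, ℝ)) :
    Matrix (Fin N) (Fin N) ℝ := fun i j =>
  if h : ∃ ω : TMS A, ω.1 0 = i ∧ ω.1 1 = j then Real.exp (f h.choose) else 0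

theorem exp_eq_transfer {f : C(TMS A, ℝ)} (hf : f ∈ locConst A 2) (ω : TMS A) :
    Real.exp (f ω) = transfer A f (ω.1 0) (ω.1 1) := by
  have h : ∃ ω' : TMS A, ω'.1 0 = ω.1 0 ∧ ω'.1 1 = ω.1 1 := ⟨ω, rfl, rfl⟩
  rw [transfer, dif_pos h]
  congr 1
  refine hf _ _ fun k hk => ?_
  interval_cases k
  exacts [h.choose_spec.1.symm, h.choose_spec.2.symm]

theorem transfer_nonneg (f : C(TMS A, ℝ)) (i j : Fin N) : 0 ≤ transfer A f i j := by
  rw [transfer]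
  split_ifs
  exacts [(Real.exp_pos _).le, le_rfl]

theorem transfer_pos (hA : IsZeroOne A) (hper : IsAperiodic A) (f : C(TMS A, ℝ)) {i j : Fin N}
    (h : A i j = 1) : 0 < transfer A f i j := by
  rw [transfer, dif_pos (exists_point_edge hA hper h)]
  exact Real.exp_pos _

theorem transfer_eq_zero (f : C(TMS A, ℝ)) {i j : Fin N} (h : A i j ≠ 1) :
    transfer A f i j = 0 := by
  rw [transfer, dif_neg]
  rintro ⟨ω, rfl, rfl⟩
  exact h (ω.2 0)

theorem continuous_transfer (i j : Fin N) :
    Continuous fun f : locConst A 2 => transfer A f i j := by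
  by_cases h : ∃ ω : TMS A, ω.1 0 = i ∧ ω.1 1 = j
  · simp only [transfer, dif_pos h]
    exact Real.continuous_exp.comp
      ((continuous_eval_const _).comp continuous_subtype_val)
  · simp only [transfer, dif_neg h]
    exact continuous_const

theorem exists_transfer_pow_pos (hA : IsZeroOne A) (hper : IsAperiodic A) (f : C(TMS A, ℝ)) :
    ∃ k, 0 < k ∧ ∀ i j, 0 < (transfer A f ^ k) i j := by
  obtain ⟨k, hk0, hk⟩ := hper
  exact ⟨k, hk0, fun i j => pow_pos_of_pos (transfer_nonneg f)
    (fun i j h => transfer_pos hA ⟨k, hk0, hk⟩ f ((hA i j).resolve_left h.ne')) k i j (hk i j)⟩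

/-- `u` is a left eigenvector of the transfer matrix in the standard simplex, and `q` is the
corresponding normalised transfer matrix. -/
def IsNormalization (f : C(TMS A, ℝ)) (u : Fin N → ℝ) (q : Matrix (Fin N) (Fin N) ℝ) : Prop :=
  u ∈ stdSimplex ℝ (Fin N) ∧ (∀ j, ∑ i, q i j = 1) ∧ ∀ i j, u i * transfer A f i j =
    (∑ b, ∑ a, u a * transfer A f a b) * u j * q i j

theorem exists_isNormalization (hN : 2 ≤ N) (hA : IsZeroOne A) (hper : IsAperiodic A)
    (f : C(TMS A, ℝ)) : ∃ u q, IsNormalization f u q := by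
  have : Nonempty (Fin N) := ⟨⟨0, by omega⟩⟩
  obtain ⟨k, hk0, hk⟩ := exists_transfer_pow_pos hA hper f
  obtain ⟨r, v, hr, hv, h⟩ := exists_pos_eigenvector (M := (transfer A f).transpose)
    (fun i j => transfer_nonneg f j i) hk0 (fun i j => by
      rw [← Matrix.transpose_pow]; exact hk j i)
  have hs : 0 < ∑ i, v i := Finset.sum_pos (fun i _ => hv i) Finset.univ_nonempty
  set u : Fin N → ℝ := fun i => v i / ∑ i, v i with hu
  have hu0 : ∀ i, 0 < u i := fun i => div_pos (hv i) hs
  have hu1 : ∑ i, u i = 1 := by rw [hu, ← Finset.sum_div, div_self hs.ne']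
  have hcol : ∀ j, ∑ i, u i * transfer A f i j = r * u j := by
    intro j
    have h1 : ∑ i, transfer A f i j * v i = r * v j := congrFun h j
    simp only [hu, div_mul_eq_mul_div, mul_comm (v _) (transfer A f _ _)]
    rw [← Finset.sum_div, h1, mul_div_assoc]
  have hr' : ∑ b, ∑ a, u a * transfer A f a b = r := by
    simp only [hcol, ← Finset.mul_sum, hu1, mul_one]
  refine ⟨u, fun i j => u i * transfer A f i j / (r * u j), ⟨fun i => (hu0 i).le, hu1⟩,
    fun j => ?_, fun i j => ?_⟩
  · rw [← Finset.sum_div, hcol, div_self (mul_pos hr (hu0 j)).ne']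
  · rw [hr', mul_div_cancel₀ _ (mul_pos hr (hu0 j)).ne']

/-- The closed conditions in `IsNormalization` only give nonnegativity; a positive power of the
transfer matrix upgrades it to strict positivity. -/
theorem IsNormalization.pos (hA : IsZeroOne A) (hper : IsAperiodic A) {f : C(TMS A, ℝ)}
    {u : Fin N → ℝ} (h : IsNormalization f u q) :
    (∀ i, 0 < u i) ∧ 0 < ∑ b, ∑ a, u a * transfer A f a b := by
  obtain ⟨hu, hq, h⟩ := h
  set r := ∑ b, ∑ a, u a * transfer A f a b with hr
  have hr0 : 0 ≤ r := Finset.sum_nonneg fun b _ => Finset.sum_nonneg fun a _ =>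
    mul_nonneg (hu.1 a) (transfer_nonneg f a b)
  obtain ⟨k, hk0, hk⟩ := exists_transfer_pow_pos hA hper f
  have heig : (transfer A f).transpose.mulVec u = r • u := by
    ext j
    have h1 : ∑ i, u i * transfer A f i j = r * u j := by
      simp only [h, ← Finset.mul_sum, hq, mul_one]
    rw [Pi.smul_apply, smul_eq_mul, ← h1]
    change ∑ i, transfer A f i j * u i = _
    exact Finset.sum_congr rfl fun i _ => mul_comm (transfer A f i j) (u i)
  have hpow : ∀ m : ℕ, ((transfer A f).transpose ^ m).mulVec u = r ^ m • u := by
    intro m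
    induction m with
    | zero => simp
    | succ m ih =>
      rw [pow_succ, ← Matrix.mulVec_mulVec, heig, Matrix.mulVec_smul, ih, smul_smul, pow_succ,
        mul_comm]
  have hne : u ≠ 0 := by
    rintro rfl
    simpa using hu.2
  have hpos : ∀ i, 0 < r ^ k * u i := fun i => by
    have h2 := mulVec_pos (B := (transfer A f).transpose ^ k)
      (fun i j => by rw [← Matrix.transpose_pow]; exact hk j i) hu.1 hne i
    rwa [hpow] at h2
  have hu0 : ∀ i, 0 < u i := fun i => pos_of_mul_pos_right (hpos i) (pow_nonneg hr0 k)
  refine ⟨hu0, lt_of_le_of_ne hr0 fun h0 => ?_⟩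
  obtain ⟨i, -⟩ := Function.ne_iff.1 hne
  have h3 := hpos i
  rw [← h0, zero_pow hk0.ne', zero_mul] at h3
  exact h3.false

theorem IsNormalization.isGMatrix (hA : IsZeroOne A) (hper : IsAperiodic A) {f : C(TMS A, ℝ)}
    {u : Fin N → ℝ} (h : IsNormalization f u q) : IsGMatrix A q := by
  obtain ⟨hu, hr⟩ := h.pos hA hper
  refine ⟨fun i j hij => ?_, fun i j hij => ?_, h.2.1⟩
  · refine pos_of_mul_pos_right ?_ (mul_pos hr (hu j)).le
    rw [← h.2.2]
    exact mul_pos (hu i) (transfer_pos hA hper f hij)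
  · have h1 := h.2.2 i j
    rw [transfer_eq_zero f hij, mul_zero] at h1
    exact (mul_eq_zero.1 h1.symm).resolve_left (mul_pos hr (hu j)).ne'

theorem IsNormalization.isCompatible (hA : IsZeroOne A) (hper : IsAperiodic A) {f : C(TMS A, ℝ)}
    (hf : f ∈ locConst A 2) {u : Fin N → ℝ} (h : IsNormalization f u q) : IsCompatible f q := by
  obtain ⟨hu, hr⟩ := h.pos hA hper
  exact ⟨_, u, hr, hu, fun ω => by rw [exp_eq_transfer hf, h.2.2]⟩

theorem exists_isGMatrix (hN : 2 ≤ N) (hA : IsZeroOne A) (hper : IsAperiodic A) {f : C(TMS A, ℝ)}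
    (hf : f ∈ locConst A 2) : ∃ q, IsGMatrix A q ∧ IsCompatible f q := by
  obtain ⟨u, q, h⟩ := exists_isNormalization hN hA hper f
  exact ⟨q, h.isGMatrix hA hper, h.isCompatible hA hper hf⟩

theorem IsCompatible.unique (hN : 2 ≤ N) (hA : IsZeroOne A) (hper : IsAperiodic A)
    {f : C(TMS A, ℝ)} (hq : IsGMatrix A q) (hq' : IsGMatrix A q') (hf : IsCompatible f q)
    (hf' : IsCompatible f q') : q = q' :=
  (isGMeasure_gibbs hN hA hper hq hf).matrix_unique (isGMeasure_gibbs hN hA hper hq' hf') hq hq'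
    hA hper

/-! ### The separating functions form an open dense set -/

/-- The functions of two coordinates whose normalised transfer matrix is separating. -/
def separatingSet (A : Matrix (Fin N) (Fin N) ℕ) : Set (locConst A 2) :=
  {f | ∃ q, IsGMatrix A q ∧ IsCompatible (f : C(TMS A, ℝ)) q ∧ IsSeparating A q}

theorem not_isSeparating_iff : ¬ IsSeparating A q ↔ ∃ e ∈ branching A ×ˢ branching A,
    e.1 ≠ e.2 ∧ q e.1.1 e.1.2 = q e.2.1 e.2.2 := by
  simp only [IsSeparating, Set.InjOn]
  push Not
  constructor
  · rintro ⟨e, he, e', he', h, hne⟩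
    exact ⟨(e, e'), ⟨he, he'⟩, hne, h⟩
  · rintro ⟨⟨e, e'⟩, ⟨he, he'⟩, hne, h⟩
    exact ⟨e, he, e', he', h, hne⟩

theorem isOpen_separatingSet (hN : 2 ≤ N) (hA : IsZeroOne A) (hper : IsAperiodic A) :
    IsOpen (separatingSet A) := by
  -- Eigenvector and normalised matrix range over a compact set. With the eigenvalue written as a
  -- sum and no division, all conditions in `Z` are closed jointly in $(f,u,q)$.
  let K : Set ((Fin N → ℝ) × (Fin N → Fin N → ℝ)) :=
    stdSimplex ℝ (Fin N) ×ˢ Set.pi Set.univ fun _ => Set.pi Set.univ fun _ => Set.Icc 0 1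
  have hK : IsCompact K := (isCompact_stdSimplex ℝ (Fin N)).prod
    (isCompact_univ_pi fun _ => isCompact_univ_pi fun _ => isCompact_Icc)
  have : CompactSpace K := isCompact_iff_compactSpace.1 hK
  let Z : Set (locConst A 2 × K) := {p | (∀ j, ∑ i, p.2.1.2 i j = 1) ∧
    (∀ i j, p.2.1.1 i * transfer A p.1 i j =
      (∑ b, ∑ a, p.2.1.1 a * transfer A p.1 a b) * p.2.1.1 j * p.2.1.2 i j) ∧
    ∃ e ∈ {e ∈ branching A ×ˢ branching A | e.1 ≠ e.2},
      p.2.1.2 e.1.1 e.1.2 = p.2.1.2 e.2.1 e.2.2}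
  have hu : ∀ i, Continuous fun p : locConst A 2 × K => p.2.1.1 i := fun i => by fun_prop
  have hq : ∀ i j, Continuous fun p : locConst A 2 × K => p.2.1.2 i j := fun i j => by fun_prop
  have hM : ∀ i j, Continuous fun p : locConst A 2 × K => transfer A p.1 i j := fun i j =>
    (continuous_transfer i j).comp continuous_fst
  have hZ : IsClosed Z := by
    have c1 : IsClosed {p : locConst A 2 × K | ∀ j, ∑ i, p.2.1.2 i j = 1} := by
      simp only [Set.ofPred_forall]
      exact isClosed_iInter fun j =>
        isClosed_eq (continuous_finsetSum _ fun i _ => hq i j) continuous_const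
    have c2 : IsClosed {p : locConst A 2 × K | ∀ i j, p.2.1.1 i * transfer A p.1 i j =
        (∑ b, ∑ a, p.2.1.1 a * transfer A p.1 a b) * p.2.1.1 j * p.2.1.2 i j} := by
      simp only [Set.ofPred_forall]
      exact isClosed_iInter fun i => isClosed_iInter fun j => isClosed_eq ((hu i).mul (hM i j))
        (((continuous_finsetSum _ fun b _ => continuous_finsetSum _ fun a _ =>
          (hu a).mul (hM a b)).mul (hu j)).mul (hq i j))
    have c3 : IsClosed {p : locConst A 2 × K | ∃ e ∈ {e ∈ branching A ×ˢ branching A | e.1 ≠ e.2},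
        p.2.1.2 e.1.1 e.1.2 = p.2.1.2 e.2.1 e.2.2} := by
      have e1 : {p : locConst A 2 × K | ∃ e ∈ {e ∈ branching A ×ˢ branching A | e.1 ≠ e.2},
          p.2.1.2 e.1.1 e.1.2 = p.2.1.2 e.2.1 e.2.2} =
          ⋃ e ∈ {e ∈ branching A ×ˢ branching A | e.1 ≠ e.2},
            {p : locConst A 2 × K | p.2.1.2 e.1.1 e.1.2 = p.2.1.2 e.2.1 e.2.2} := by
        ext p
        simp only [Set.mem_iUnion, exists_prop]
        rfl
      rw [e1]
      exact (Set.toFinite _).isClosed_biUnion fun e _ => isClosed_eq (hq _ _) (hq _ _)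
    exact c1.inter (c2.inter c3)
  -- Uniqueness of the compatible matrix is essential here: one non-separating normalisation already
  -- excludes membership in `separatingSet`.
  have hcompl : (separatingSet A)ᶜ = Prod.fst '' Z := by
    ext f
    constructor
    · intro hf
      obtain ⟨u, q, h⟩ := exists_isNormalization hN hA hper (f : C(TMS A, ℝ))
      have hg := h.isGMatrix hA hper
      have hns : ¬ IsSeparating A q := fun hs => hf ⟨q, hg, h.isCompatible hA hper f.2, hs⟩
      obtain ⟨e, he, hne, heq⟩ := not_isSeparating_iff.1 hns
      have hmem : (u, q) ∈ K := ⟨h.1, fun i _ j _ => ⟨hg.nonneg i j, by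
        rw [← hg.sum j]
        exact Finset.single_le_sum (fun l _ => hg.nonneg l j) (Finset.mem_univ i)⟩⟩
      exact ⟨(f, ⟨(u, q), hmem⟩), ⟨h.2.1, h.2.2, e, ⟨he, hne⟩, heq⟩, rfl⟩
    · rintro ⟨⟨g, ⟨⟨u, q⟩, hK⟩⟩, ⟨h1, h2, e, ⟨he, hne⟩, heq⟩, rfl⟩ ⟨q', hq', hc', hs'⟩
      have h : IsNormalization (g : C(TMS A, ℝ)) u q := ⟨hK.1, h1, h2⟩
      obtain rfl := IsCompatible.unique hN hA hper (h.isGMatrix hA hper) hq'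
        (h.isCompatible hA hper g.2) hc'
      exact not_isSeparating_iff.2 ⟨e, he, hne, heq⟩ hs'
  rw [← isClosed_compl_iff, hcompl]
  exact isClosedMap_fst_of_compactSpace _ hZ

/-- Each coincidence of two branching entries cuts out a proper subspace of the admissible
directions, and finitely many proper subspaces do not cover a real vector space. -/
theorem exists_separating_direction (A : Matrix (Fin N) (Fin N) ℕ) :
    ∃ δ : Matrix (Fin N) (Fin N) ℝ, (∀ i j, A i j ≠ 1 → δ i j = 0) ∧ (∀ j, ∑ i, δ i j = 0) ∧
      IsSeparating A δ := by
  let V : Submodule ℝ (Matrix (Fin N) (Fin N) ℝ) :=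
    { carrier := {δ | (∀ i j, A i j ≠ 1 → δ i j = 0) ∧ ∀ j, ∑ i, δ i j = 0}
      zero_mem' := by simp
      add_mem' := fun {a b} ha hb => ⟨fun i j h => by simp [ha.1 i j h, hb.1 i j h],
        fun j => by simp [Finset.sum_add_distrib, ha.2 j, hb.2 j]⟩
      smul_mem' := fun c a ha => ⟨fun i j h => by simp [ha.1 i j h],
        fun j => by simp [← Finset.mul_sum, ha.2 j]⟩ }
  let P := {e : (Fin N × Fin N) × (Fin N × Fin N) // e ∈ branching A ×ˢ branching A ∧ e.1 ≠ e.2}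
  let φ : P → Module.Dual ℝ (Matrix (Fin N) (Fin N) ℝ) := fun e =>
    Matrix.entryLinearMap ℝ ℝ e.1.1.1 e.1.1.2 - Matrix.entryLinearMap ℝ ℝ e.1.2.1 e.1.2.2
  have hφ : ∀ (e : P) δ, φ e δ = δ e.1.1.1 e.1.1.2 - δ e.1.2.1 e.1.2.2 := fun e δ => rfl
  obtain ⟨δ, ⟨h1, h2⟩, h3⟩ := Module.Dual.exists_forall_mem_ne_zero_of_forall_exists V φ (by
    rintro ⟨⟨⟨i, j⟩, ⟨i', j'⟩⟩, ⟨⟨hA, l, hl, hlA⟩, he'⟩, hne⟩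
    simp only at hl hlA hA
    -- Move mass in column `j` from another predecessor `l` to `i`: the entry at `(i, j)` is $1$ and
    -- every other entry is at most $0$.
    refine ⟨fun a b => if b = j then (if a = i then 1 else 0) - (if a = l then 1 else 0) else 0,
      ⟨fun a b hab => ?_, fun b => ?_⟩, ?_⟩
    · by_cases hb : b = j
      · subst hb
        have h1 : a ≠ i := fun h => hab (h ▸ hA)
        have h2 : a ≠ l := fun h => hab (h ▸ hlA)
        simp [h1, h2]
      · simp [hb]
    · by_cases hb : b = j
      · simp [hb]
      · simp [hb]
    · intro h0
      replace h0 := (hφ _ _).symm.trans h0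
      simp only [if_true, hl.symm, if_false, sub_zero] at h0
      have hle : (if j' = j then (if i' = i then 1 else 0) - (if i' = l then 1 else 0) else 0 : ℝ)
          ≤ 0 := by
        by_cases hj : j' = j
        · have hi : i' ≠ i := fun hi => hne (by simp [hi, hj])
          simp only [hj, hi, if_true, if_false]
          split_ifs <;> norm_num
        · simp [hj]
      linarith)
  refine ⟨δ, h1, h2, fun e he e' he' heq => ?_⟩
  by_contra hne
  exact h3 ⟨(e, e'), ⟨he, he'⟩, hne⟩ (by rw [hφ]; exact sub_eq_zero.2 heq)

theorem dense_separatingSet (hN : 2 ≤ N) (hA : IsZeroOne A) (hper : IsAperiodic A) :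
    Dense (separatingSet A) := by
  rw [Metric.dense_iff]
  intro f ε hε
  obtain ⟨q, hq, r, u, hr, hu, hf⟩ := exists_isGMatrix hN hA hper f.2
  obtain ⟨δ, hδ0, hδ1, hδs⟩ := exists_separating_direction A
  have hlim : ∀ i j, Filter.Tendsto (fun t : ℝ => q i j + t * δ i j) (nhdsWithin 0 {0}ᶜ)
      (nhds (q i j)) := fun i j => by
    have h : Continuous fun t : ℝ => q i j + t * δ i j := by fun_prop
    simpa using (h.tendsto 0).mono_left nhdsWithin_le_nhds
  have hpos : ∀ᶠ t : ℝ in nhdsWithin 0 {0}ᶜ, ∀ i j, A i j = 1 → 0 < q i j + t * δ i j := by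
    rw [Filter.eventually_all]; intro i
    rw [Filter.eventually_all]; intro j
    by_cases h : A i j = 1
    · filter_upwards [(hlim i j).eventually (lt_mem_nhds (hq.pos i j h))] with t ht _ using ht
    · exact Filter.Eventually.of_forall fun t h' => absurd h' h
  have hsmall : ∀ᶠ t : ℝ in nhdsWithin 0 {0}ᶜ, ∀ i j, A i j = 1 →
      |Real.log ((q i j + t * δ i j) / q i j)| < ε := by
    rw [Filter.eventually_all]; intro i
    rw [Filter.eventually_all]; intro j
    by_cases h : A i j = 1
    · have h0 := (hq.pos i j h).ne'
      have h1 := (((hlim i j).div_const (q i j)).log (by rw [div_self h0]; norm_num)).abs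
      rw [div_self h0, Real.log_one, abs_zero] at h1
      filter_upwards [h1.eventually (gt_mem_nhds hε)] with t ht _ using ht
    · exact Filter.Eventually.of_forall fun t h' => absurd h' h
  -- For two distinct branching transitions the perturbed values are affine in `t` with different
  -- slopes, so they coincide for at most one `t`.
  have hsep : ∀ᶠ t : ℝ in nhdsWithin 0 {0}ᶜ, ∀ e e' : Fin N × Fin N, e ∈ branching A →
      e' ∈ branching A → q e.1 e.2 + t * δ e.1 e.2 = q e'.1 e'.2 + t * δ e'.1 e'.2 → e = e' := by
    rw [Filter.eventually_all]; intro e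
    rw [Filter.eventually_all]; intro e'
    by_cases he : e ∈ branching A ∧ e' ∈ branching A ∧ e ≠ e'
    · have hd : δ e.1 e.2 - δ e'.1 e'.2 ≠ 0 := fun h =>
        he.2.2 (hδs he.1 he.2.1 (sub_eq_zero.1 h))
      set t₀ := (q e'.1 e'.2 - q e.1 e.2) / (δ e.1 e.2 - δ e'.1 e'.2) with ht₀
      have hne : ∀ t : ℝ, t ≠ t₀ →
          q e.1 e.2 + t * δ e.1 e.2 ≠ q e'.1 e'.2 + t * δ e'.1 e'.2 := by
        intro t ht h
        refine ht ?_
        rw [ht₀, eq_div_iff hd]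
        linarith
      have hev : ∀ᶠ t : ℝ in nhdsWithin 0 {0}ᶜ, t ≠ t₀ := by
        by_cases h0 : t₀ = 0
        · rw [h0]; exact eventually_mem_nhdsWithin
        · exact (eventually_ne_nhds (Ne.symm h0)).filter_mono nhdsWithin_le_nhds
      filter_upwards [hev] with t ht _ _ h using absurd h (hne t ht)
    · refine Filter.Eventually.of_forall fun t h1 h2 _ => by_contra fun h3 => he ⟨h1, h2, h3⟩
  obtain ⟨t, ht1, ht2, ht3⟩ := (hpos.and (hsmall.and hsep)).exists
  -- Adding the logarithm of the ratio of new to old matrix makes the perturbed matrix compatible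
  -- with `g` through the same `r` and `u`.
  let g : TMS A → ℝ := fun ω => (f : C(TMS A, ℝ)) ω +
    Real.log ((q (ω.1 0) (ω.1 1) + t * δ (ω.1 0) (ω.1 1)) / q (ω.1 0) (ω.1 1))
  have hg : IsLocConst A 2 g := fun ω ω' h => by
    simp only [g, f.2 ω ω' h, h 0 two_pos, h 1 one_lt_two]
  refine ⟨⟨⟨g, hg.continuous⟩, hg⟩, ?_, fun i j => q i j + t * δ i j, ⟨fun i j h => ht1 i j h,
    fun i j h => by simp [hq.zero i j h, hδ0 i j h], fun j => by
      rw [Finset.sum_add_distrib, ← Finset.mul_sum, hq.sum, hδ1, mul_zero, add_zero]⟩,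
    ⟨r, u, hr, hu, fun ω => ?_⟩, fun e he e' he' h => ht3 e e' he he' h⟩
  · rw [Metric.mem_ball, Subtype.dist_eq, ContinuousMap.dist_lt_iff hε]
    intro ω
    change dist (g ω) ((f : C(TMS A, ℝ)) ω) < ε
    rw [Real.dist_eq, add_sub_cancel_left]
    exact ht2 _ _ (ω.2 0)
  · change u (ω.1 0) * Real.exp (g ω) = _
    have h0 := hq.pos _ _ (ω.2 0)
    have h1 := ht1 _ _ (ω.2 0)
    rw [Real.exp_add, Real.exp_log (div_pos h1 h0), ← mul_assoc, hf, mul_assoc (r * _),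
      mul_div_cancel₀ _ h0.ne']

end MarkovShift

theorem mainTheorem4 (N : ℕ) (hN : 2 ≤ N) (A : Matrix (Fin N) (Fin N) ℕ)
    (hA : MarkovShift.IsZeroOne A) (hper : MarkovShift.IsAperiodic A)
    (hsucc : (Finset.univ.filter fun i => MarkovShift.numSucc A i = 1).card ≤ 1) :
    ∃ U : Set (MarkovShift.locConst A 2), IsOpen U ∧ Dense U ∧
      U ⊆ {f | MarkovShift.equivClass A (MarkovShift.locConst A 2) f =
        MarkovShift.isoClass A (MarkovShift.locConst A 2) f} := by
  refine ⟨MarkovShift.separatingSet A, MarkovShift.isOpen_separatingSet hN hA hper,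
    MarkovShift.dense_separatingSet hN hA hper, ?_⟩
  rintro f ⟨q, hq, hf, hs⟩
  ext g
  refine and_congr_right fun hg => ?_
  obtain ⟨q', hq', hg'⟩ := MarkovShift.exists_isGMatrix hN hA hper hg
  have hμ := MarkovShift.isGMeasure_gibbs hN hA hper hq hf
  have hν := MarkovShift.isGMeasure_gibbs hN hA hper hq' hg'
  have := hμ.prob
  have := hν.prob
  exact ⟨fun h => h.areIsomorphic,
    MarkovShift.areEquivalent_of_areIsomorphic hN hA hper hμ hν hq hq' hs⟩
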